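/- All graphs are finite, simple and undirected. For a graph $G=(V,E)$ and $U\subseteq V$ let $t(U)$ be the number of edges with at least one endpoint in $U$ and $e(U)$ the number of edges with both endpoints in $U$. Consider three problems. - **MWEC** (maximum weight $m'$-edge cover): given $G$ with integral vertex weights $w\ge 0$ and a number $m'$, find $U\subseteq V$ of maximum weight $w(U)=\sum_{v\in U}w(v)$ subject to $t(U)\le m'$. - **FCEC** (fixed cost minimum edge cover): given $G$ with integral vertex weights $w\ge 0$ and a number $W$, find $U\subseteq V$ with $w(U)\ge W$ that minimizes $t(U)$. - **Dense $k$-subgraph**: given $G$ and a number $k$, find $U\subseteq V$ with $|U|=k$ that maximizes $e(U)$. An instance of MWEC or FCEC is unweighted if $w\equiv 1$. For $\rho\ge 1$, a $\rho$-approximation algorithm is a deterministic polynomial-time algorithm which, on every instance (of the class under consideration) that has a feasible solution, returns a feasible solution whose value is within the factor $\rho$ of the optimum. A PTAS is a family of such algorithms, a $(1+\varepsilon)$-approximation algorithm for each constant $\varepsilon>0$. For positive constants $c_1,a,b,c,d$, a *modified instance* of Dense $k$-subgraph is a pair $\langle G,k\rangle$, where $G$ has $n$ vertices, such that 1. every vertex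 of $G$ has degree at most $c_1n^{1/3}$; 2. $a\,n^{2/3}\le k\le b\,n^{2/3}$; 3. the subgraph induced by an optimal set of $k$ vertices has average degree between $c\,n^{1/3}$ and $d\,n^{1/3}$. **Theorem.** (i) If unweighted MWEC has a PTAS, then unweighted FCEC restricted to regular graphs has a PTAS. (This covers in particular every class of regular graphs, such as the $\Delta$-regular graphs that are built from the modified instances.) (ii) Let $c_1,a,b,c,d>0$ be constants. If the modified instances of Dense $k$-subgraph with these constants do not admit a polynomial-time approximation algorithm with a constant ratio, then neither unweighted MWEC nor (weighted) MWEC has a PTAS. -/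

import Mathlib

/-! ### A machine model with a running time

Programs of a small variable-free language that works on binary trees (the data type of Lisp).
Every primitive operation costs one plus the size of the tree it is applied to, hence the cost of
a run bounds from above the number of operations and the size of every tree that occurs in it, and
the model simulates, and is simulated by, Turing machines with polynomial overhead. -/

/-- Binary trees, the only data type of the programs. -/
inductive Data : Type
  | nil : Data
  | cons : Data → Data → Data

/-- The number of nodes of a tree, leaves included. -/
def Data.size : Data → ℕ
  | .nil => 1
  | .cons a b => a.size + b.size + 1

/-- The first component; the first component of `nil` is `nil`. -/
def Data.fst : Data → Data
  | .nil => .nil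
  | .cons a _ => a

/-- The second component; the second component of `nil` is `nil`. -/
def Data.snd : Data → Data
  | .nil => .nil
  | .cons _ b => b

/-- Programs. Each one denotes a partial function from trees to trees; `nil` plays the role of
"false" and every other tree that of "true". -/
inductive Prog : Type
  | id : Prog
  | nil : Prog
  | fst : Prog
  | snd : Prog
  /-- run both programs on the input and pair the results -/
  | pair (f g : Prog) : Prog
  /-- run `f`, then run `g` on the result -/
  | seq (f g : Prog) : Prog
  /-- if `c` then `f` else `g` -/
  | cond (c f g : Prog) : Prog
  /-- while `c` do `f` -/
  | loop (c f : Prog) : Prog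

/-- `p.Runs x y t`: on input `x` the program `p` halts with output `y` after `t` time units. -/
inductive Prog.Runs : Prog → Data → Data → ℕ → Prop
  | id (x : Data) : Prog.Runs .id x x (x.size + 1)
  | nil (x : Data) : Prog.Runs .nil x .nil (x.size + 1)
  | fst (x : Data) : Prog.Runs .fst x x.fst (x.size + 1)
  | snd (x : Data) : Prog.Runs .snd x x.snd (x.size + 1)
  | pair {f g : Prog} {x y z : Data} {s t : ℕ} (hf : Prog.Runs f x y s) (hg : Prog.Runs g x z t) :
      Prog.Runs (.pair f g) x (.cons y z) (s + t + 1)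
  | seq {f g : Prog} {x y z : Data} {s t : ℕ} (hf : Prog.Runs f x y s) (hg : Prog.Runs g y z t) :
      Prog.Runs (.seq f g) x z (s + t + 1)
  | cond_true {c f g : Prog} {x a b y : Data} {s t : ℕ} (hc : Prog.Runs c x (.cons a b) s)
      (hf : Prog.Runs f x y t) : Prog.Runs (.cond c f g) x y (s + t + 1)
  | cond_false {c f g : Prog} {x y : Data} {s t : ℕ} (hc : Prog.Runs c x .nil s)
      (hg : Prog.Runs g x y t) : Prog.Runs (.cond c f g) x y (s + t + 1)
  | loop_stop {c f : Prog} {x : Data} {s : ℕ} (hc : Prog.Runs c x .nil s) :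
      Prog.Runs (.loop c f) x x (s + 1)
  | loop_step {c f : Prog} {x a b y z : Data} {s t u : ℕ} (hc : Prog.Runs c x (.cons a b) s)
      (hf : Prog.Runs f x y t) (hl : Prog.Runs (.loop c f) y z u) :
      Prog.Runs (.loop c f) x z (s + t + u + 1)

/-! ### Encodings -/

/-- A truth value as a tree. -/
def encBool : Bool → Data
  | false => .nil
  | true => .cons .nil .nil

/-- A list as a tree. -/
def encList {α : Type} (enc : α → Data) : List α → Data
  | [] => .nil
  | a :: l => .cons (enc a) (encList enc l)

/-- A natural number in binary, least significant bit first. -/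
def encNat (k : ℕ) : Data := encList encBool k.bits

open Classical in
/-- A graph as its adjacency matrix, row by row. -/
noncomputable def encGraph {n : ℕ} (G : SimpleGraph (Fin n)) : Data :=
  encList (encList encBool)
    (List.ofFn fun i : Fin n => List.ofFn fun j : Fin n => decide (G.Adj i j))

/-- A set of vertices as its characteristic vector. -/
def encVertexSet {n : ℕ} (U : Finset (Fin n)) : Data :=
  encList encBool (List.ofFn fun i : Fin n => decide (i ∈ U))

/-! ### Optimization problems and approximation algorithms -/

/-- The two kinds of optimization problems. -/
inductive Goal : Type
  | maximize : Goal
  | minimize : Goal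

/-- An optimization problem, with encodings of its instances and of its solutions. -/
structure OptProblem where
  Inst : Type
  Sol : Inst → Type
  encInst : Inst → Data
  encSol : (I : Inst) → Sol I → Data
  Feasible : (I : Inst) → Sol I → Prop
  value : (I : Inst) → Sol I → ℕ
  goal : Goal

namespace OptProblem

/-- The same problem on the instances from `C` only: an algorithm for it may behave arbitrarily
on the other instances. -/
def restrict (P : OptProblem) (C : Set P.Inst) : OptProblem where
  Inst := {I : P.Inst // I ∈ C}
  Sol I := P.Sol I.1
  encInst I := P.encInst I.1
  encSol I S := P.encSol I.1 S
  Feasible I S := P.Feasible I.1 S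
  value I S := P.value I.1 S
  goal := P.goal

/-- `S` is at least as good as `S'` up to the factor `ρ`. -/
def WithinFactor (P : OptProblem) (ρ : ℝ) (I : P.Inst) (S S' : P.Sol I) : Prop :=
  match P.goal with
  | .maximize => (P.value I S' : ℝ) ≤ ρ * P.value I S
  | .minimize => (P.value I S : ℝ) ≤ ρ * P.value I S'

/-- There is a polynomial-time `ρ`-approximation algorithm: on every instance that has a feasible
solution it returns, in time polynomial in the size of the encoded instance, a feasible solution
that is within the factor `ρ` of every feasible solution. -/
def HasApprox (P : OptProblem) (ρ : ℝ) : Prop :=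
  ∃ (p : Prog) (q : Polynomial ℕ), ∀ I : P.Inst, (∃ S, P.Feasible I S) →
    ∃ (S : P.Sol I) (t : ℕ),
      p.Runs (P.encInst I) (P.encSol I S) t ∧ t ≤ q.eval (P.encInst I).size ∧
      P.Feasible I S ∧ ∀ S', P.Feasible I S' → P.WithinFactor ρ I S S'

/-- A polynomial-time approximation scheme. -/
def HasPTAS (P : OptProblem) : Prop :=
  ∀ ε : ℝ, 0 < ε → P.HasApprox (1 + ε)

/-- A polynomial-time approximation algorithm with a constant ratio. -/
def HasConstantApprox (P : OptProblem) : Prop :=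
  ∃ ρ : ℝ, P.HasApprox ρ

end OptProblem

/-! ### The graph problems -/

/-- `t(U)`: the number of edges with at least one endpoint in `U`. -/
noncomputable def touchCount {n : ℕ} (G : SimpleGraph (Fin n)) (U : Finset (Fin n)) : ℕ :=
  {e : Sym2 (Fin n) | e ∈ G.edgeSet ∧ ∃ v ∈ e, v ∈ U}.ncard

/-- `e(U)`: the number of edges with both endpoints in `U`. -/
noncomputable def internalCount {n : ℕ} (G : SimpleGraph (Fin n)) (U : Finset (Fin n)) : ℕ :=
  {e : Sym2 (Fin n) | e ∈ G.edgeSet ∧ ∀ v ∈ e, v ∈ U}.ncard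

/-- A vertex-weighted graph with a number (the edge budget `m'`, or the weight bound `W`). -/
structure WeightedInstance where
  n : ℕ
  graph : SimpleGraph (Fin n)
  weight : Fin n → ℕ
  bound : ℕ

namespace WeightedInstance

/-- The encoding of an instance. -/
noncomputable def enc (I : WeightedInstance) : Data :=
  .cons (encGraph I.graph) (.cons (encList encNat (List.ofFn I.weight)) (encNat I.bound))

/-- Unweighted instances: all weights are 1. -/
def Unweighted (I : WeightedInstance) : Prop := ∀ v, I.weight v = 1

open Classical in
/-- The graph is `Δ`-regular for some `Δ`. -/
def Regular (I : WeightedInstance) : Prop := ∃ Δ : ℕ, I.graph.IsRegularOfDegree Δ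

end WeightedInstance

/-- Maximum weight `m'`-edge cover: maximize the weight of `U` subject to `t(U) ≤ m'`. -/
noncomputable def mwec : OptProblem where
  Inst := WeightedInstance
  Sol I := Finset (Fin I.n)
  encInst I := I.enc
  encSol _ U := encVertexSet U
  Feasible I U := touchCount I.graph U ≤ I.bound
  value I U := ∑ v ∈ U, I.weight v
  goal := .maximize

/-- Fixed cost minimum edge cover: minimize `t(U)` subject to the weight of `U` being at
least `W`. -/
noncomputable def fcec : OptProblem where
  Inst := WeightedInstance
  Sol I := Finset (Fin I.n)
  encInst I := I.enc
  encSol _ U := encVertexSet U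
  Feasible I U := I.bound ≤ ∑ v ∈ U, I.weight v
  value I U := touchCount I.graph U
  goal := .minimize

/-- An instance `⟨G, k⟩` of Dense `k`-subgraph. -/
structure DkSInstance where
  n : ℕ
  graph : SimpleGraph (Fin n)
  k : ℕ

/-- Dense `k`-subgraph: maximize `e(U)` over the sets `U` of exactly `k` vertices. -/
noncomputable def denseKSubgraph : OptProblem where
  Inst := DkSInstance
  Sol I := Finset (Fin I.n)
  encInst I := .cons (encGraph I.graph) (encNat I.k)
  encSol _ U := encVertexSet U
  Feasible I U := U.card = I.k
  value I U := internalCount I.graph U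
  goal := .maximize

open Classical in
/-- The modified instances of Dense `k`-subgraph, for given constants in the `O` and the `Θ`s:
the maximum degree is `O(n^{1/3})`, `k = Θ(n^{2/3})`, and the subgraph induced by an optimal set
of `k` vertices has average degree `Θ(n^{1/3})`. -/
def ModifiedDkS (c₁ a b c d : ℝ) (I : DkSInstance) : Prop :=
  (∀ v, (I.graph.degree v : ℝ) ≤ c₁ * (I.n : ℝ) ^ (1 / 3 : ℝ)) ∧
  (a * (I.n : ℝ) ^ (2 / 3 : ℝ) ≤ I.k ∧ (I.k : ℝ) ≤ b * (I.n : ℝ) ^ (2 / 3 : ℝ)) ∧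
  ∃ U : Finset (Fin I.n), U.card = I.k ∧
    (∀ U' : Finset (Fin I.n), U'.card = I.k →
      internalCount I.graph U' ≤ internalCount I.graph U) ∧
    c * (I.n : ℝ) ^ (1 / 3 : ℝ) ≤ 2 * internalCount I.graph U / I.k ∧
    2 * internalCount I.graph U / I.k ≤ d * (I.n : ℝ) ^ (1 / 3 : ℝ)

/-! ### Running times -/

/-! Both parts rest on one algorithm (`exists_polyTime_dense`). Let `Δ` be the maximum degree of `G`
and `N ≥ 1` a constant. Given a PTAS for unweighted MWEC, the algorithm finds for `(G, k)` with `k ≤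
n` a `k`-set `W` such that `e(S) ≤ e(W) + Δk/(N+1)` for all `k`-sets `S`.

In every graph `t(U) + e(U)` is the degree sum over `U` (`touchCount_add_internalCount`). So if all
vertices of `U` have degree `Δ`, few touched edges mean many internal ones. To reach this situation,
`G` is joined to a large clique that raises each old degree to exactly `Δ` without changing `e(U)`
for sets of old vertices (`touchCount_equalized`). A clique vertex touches more edges than any
budget in use, so MWEC solutions contain old vertices only (`exists_map_castAdd_of_touchCount`).

MWEC with ratio `1 + 1/N` is run for each budget up to `n²`, and the least budget whose answer `U`
satisfies `(N+1)|U| ≥ Nk` is kept. The budget `t(S)` passes this test for every `k`-set `S`, hence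
`t(U) ≤ t(S)`. Padding or trimming `U` to `k` elements costs at most `Δk/(N+1)` internal edges
(`internalCount_le_of_touchCount_le`).

This additive error is harmless in both applications. In a regular graph `Δk = t(S) + e(S) ≤ 2t(S)`,
which gives FCEC the ratio `1 + 2/(N+1)`. In a modified instance `Δk` is at most a constant times
the optimum, so a large `N` gives ratio 2.

Polynomial running time is obtained from closure properties of `PolyTime`, chiefly under folds with
bounded accumulators. -/

theorem Data.size_pos (x : Data) : 1 ≤ x.size := by
  cases x <;> simp [Data.size]

theorem Data.size_fst_le (x : Data) : x.fst.size ≤ x.size := by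
  cases x <;> simp only [Data.size, Data.fst] <;> omega

theorem Data.size_snd_le (x : Data) : x.snd.size ≤ x.size := by
  cases x <;> simp only [Data.size, Data.snd] <;> omega

theorem Prog.Runs.size_input_le {p : Prog} {x y : Data} {t : ℕ} (h : p.Runs x y t) :
    x.size ≤ t := by
  induction h <;> omega

/-- Every primitive pays for the size of its input, so time bounds space. This is what makes
polynomial time closed under composition. -/
theorem Prog.Runs.size_output_le {p : Prog} {x y : Data} {t : ℕ} (h : p.Runs x y t) :
    y.size ≤ t := by
  induction h with
  | id x => omega
  | nil x => simp [Data.size]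
  | fst x => have := x.size_fst_le; omega
  | snd x => have := x.size_snd_le; omega
  | pair _ _ ihf ihg => simp only [Data.size]; omega
  | seq => omega
  | cond_true => omega
  | cond_false => omega
  | loop_stop hc => have := hc.size_input_le; omega
  | loop_step => omega

theorem Polynomial.eval_nat_mono (q : Polynomial ℕ) {m n : ℕ} (h : m ≤ n) :
    q.eval m ≤ q.eval n := by
  simp only [Polynomial.eval_eq_sum_range]
  exact Finset.sum_le_sum fun i _ => Nat.mul_le_mul_left _ (Nat.pow_le_pow_left h i)

/-! ### Types with an encoding, polynomial bounds, polynomial-time functions -/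

/-- A type whose elements are encoded as trees. -/
class TreeCode (α : Type) where
  code : α → Data

open TreeCode (code)

/-- The size of the encoding. -/
def codeSize {α : Type} [TreeCode α] (x : α) : ℕ := (code x).size

instance : TreeCode Data := ⟨fun x => x⟩

instance : TreeCode Bool := ⟨encBool⟩

/-- Natural numbers are encoded in unary. -/
instance : TreeCode ℕ := ⟨fun k => encList (fun _ => Data.nil) (List.replicate k ())⟩

instance {α β : Type} [TreeCode α] [TreeCode β] : TreeCode (α × β) :=
  ⟨fun x => .cons (code x.1) (code x.2)⟩

instance {α : Type} [TreeCode α] : TreeCode (List α) := ⟨encList code⟩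

/-- The function is bounded by a polynomial in the size of the encoding of its argument. -/
def PolyBounded {α : Type} [TreeCode α] (g : α → ℕ) : Prop :=
  ∃ q : Polynomial ℕ, ∀ x, g x ≤ q.eval (codeSize x)

/-- The function is computed by a program in polynomial time. -/
def PolyTime {α β : Type} [TreeCode α] [TreeCode β] (f : α → β) : Prop :=
  ∃ (p : Prog) (q : Polynomial ℕ), ∀ x, ∃ t,
    p.Runs (code x) (code (f x)) t ∧ t ≤ q.eval (codeSize x)

section

variable {α β γ σ : Type} [TreeCode α] [TreeCode β] [TreeCode γ] [TreeCode σ]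

/-! ### Sizes of encodings -/

theorem codeSize_pos (x : α) : 1 ≤ codeSize x := Data.size_pos _

theorem codeSize_mk (x : α) (y : β) : codeSize (x, y) = codeSize x + codeSize y + 1 := rfl

theorem codeSize_nil : codeSize ([] : List α) = 1 := rfl

theorem codeSize_cons (x : α) (l : List α) :
    codeSize (x :: l) = codeSize x + codeSize l + 1 := rfl

theorem codeSize_bool_le (b : Bool) : codeSize b ≤ 3 := by
  cases b <;> simp [codeSize, code, encBool, Data.size]

theorem codeSize_nat (k : ℕ) : codeSize k = 2 * k + 1 := by
  induction k with
  | zero => rfl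
  | succ k ih =>
    have : codeSize (k + 1) = 1 + codeSize k + 1 := rfl
    omega

theorem code_nat_succ (k : ℕ) : code (k + 1) = Data.cons .nil (code k) := rfl

theorem length_le_codeSize (l : List α) : l.length ≤ codeSize l := by
  induction l with
  | nil => simp
  | cons a l ih => simp only [List.length_cons, codeSize_cons]; omega

theorem codeSize_le_of_mem {a : α} {l : List α} (h : a ∈ l) : codeSize a ≤ codeSize l := by
  induction l with
  | nil => simp at h
  | cons b l ih =>
    rw [codeSize_cons]
    rcases List.mem_cons.1 h with rfl | h
    · omega
    · have := ih h; omega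

theorem codeSize_list_le {l : List α} {B : ℕ} (h : ∀ a ∈ l, codeSize a ≤ B) :
    codeSize l ≤ l.length * (B + 1) + 1 := by
  induction l with
  | nil => simp [codeSize_nil]
  | cons a l ih =>
    have h1 := ih fun b hb => h b (List.mem_cons_of_mem _ hb)
    have h2 := h a List.mem_cons_self
    rw [codeSize_cons, List.length_cons, add_mul]
    omega

/-! ### Closure of polynomial bounds -/

theorem PolyBounded.mono {g g' : α → ℕ} (hg : PolyBounded g) (h : ∀ x, g' x ≤ g x) :
    PolyBounded g' := by
  obtain ⟨q, hq⟩ := hg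
  exact ⟨q, fun x => (h x).trans (hq x)⟩

theorem PolyBounded.const (k : ℕ) : PolyBounded fun _ : α => k :=
  ⟨Polynomial.C k, fun x => by simp⟩

theorem PolyBounded.self : PolyBounded fun x : α => codeSize x :=
  ⟨Polynomial.X, fun x => by simp⟩

theorem PolyBounded.add {g h : α → ℕ} (hg : PolyBounded g) (hh : PolyBounded h) :
    PolyBounded fun x => g x + h x := by
  obtain ⟨q, hq⟩ := hg
  obtain ⟨r, hr⟩ := hh
  exact ⟨q + r, fun x => by rw [Polynomial.eval_add]; exact add_le_add (hq x) (hr x)⟩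

theorem PolyBounded.mul {g h : α → ℕ} (hg : PolyBounded g) (hh : PolyBounded h) :
    PolyBounded fun x => g x * h x := by
  obtain ⟨q, hq⟩ := hg
  obtain ⟨r, hr⟩ := hh
  exact ⟨q * r, fun x => by rw [Polynomial.eval_mul]; exact Nat.mul_le_mul (hq x) (hr x)⟩

theorem PolyBounded.eval (q : Polynomial ℕ) {g : α → ℕ} (hg : PolyBounded g) :
    PolyBounded fun x => q.eval (g x) := by
  obtain ⟨r, hr⟩ := hg
  exact ⟨q.comp r, fun x => by rw [Polynomial.eval_comp]; exact q.eval_nat_mono (hr x)⟩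

/-! ### Closure of polynomial time under the basic constructions -/

theorem PolyTime.intro {f : α → β} (p : Prog) {T : α → ℕ} (hT : PolyBounded T)
    (h : ∀ x, ∃ t, p.Runs (code x) (code (f x)) t ∧ t ≤ T x) : PolyTime f := by
  obtain ⟨q, hq⟩ := hT
  refine ⟨p, q, fun x => ?_⟩
  obtain ⟨t, h1, h2⟩ := h x
  exact ⟨t, h1, h2.trans (hq x)⟩

theorem PolyTime.bounded_codeSize {f : α → β} (hf : PolyTime f) :
    PolyBounded fun x => codeSize (f x) := by
  obtain ⟨p, q, h⟩ := hf
  refine ⟨q, fun x => ?_⟩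
  obtain ⟨t, h1, h2⟩ := h x
  exact h1.size_output_le.trans h2

/-- Output is unary here, so the value itself, not only its number of digits, is bounded by the
running time. -/
theorem PolyTime.bounded {f : α → ℕ} (hf : PolyTime f) : PolyBounded f :=
  hf.bounded_codeSize.mono fun x => by rw [codeSize_nat]; omega

/-- Only the encodings of the values matter. -/
theorem PolyTime.recode {f : α → β} {g : α → γ} (hf : PolyTime f)
    (h : ∀ x, code (f x) = code (g x)) : PolyTime g := by
  obtain ⟨p, q, hp⟩ := hf
  exact ⟨p, q, fun x => by rw [← h x]; exact hp x⟩

theorem PolyTime.congr {f g : α → β} (hf : PolyTime f) (h : ∀ x, f x = g x) : PolyTime g :=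
  hf.recode fun x => by rw [h x]

/-- Only the encodings of the arguments matter. -/
theorem PolyTime.precode {f : β → γ} (hf : PolyTime f) {g : α → γ} (i : α → β)
    (hi : ∀ x, code x = code (i x)) (h : ∀ x, code (f (i x)) = code (g x)) : PolyTime g := by
  obtain ⟨p, q, hp⟩ := hf
  refine ⟨p, q, fun x => ?_⟩
  obtain ⟨t, h1, h2⟩ := hp (i x)
  refine ⟨t, ?_, ?_⟩
  · rw [hi x, ← h x]; exact h1
  · unfold codeSize at h2 ⊢
    rw [hi x]
    exact h2

theorem PolyTime.id : PolyTime fun x : α => x :=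
  PolyTime.intro .id (PolyBounded.self.add (.const 1)) fun _ => ⟨_, .id _, le_rfl⟩

theorem PolyTime.fst : PolyTime fun x : α × β => x.1 :=
  PolyTime.intro .fst (PolyBounded.self.add (.const 1)) fun _ => ⟨_, .fst _, le_rfl⟩

theorem PolyTime.snd : PolyTime fun x : α × β => x.2 :=
  PolyTime.intro .snd (PolyBounded.self.add (.const 1)) fun _ => ⟨_, .snd _, le_rfl⟩

theorem PolyTime.comp {g : β → γ} {f : α → β} (hg : PolyTime g) (hf : PolyTime f) :
    PolyTime fun x => g (f x) := by
  have hs := hf.bounded_codeSize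
  obtain ⟨p, q, hp⟩ := hg
  obtain ⟨p', q', hp'⟩ := hf
  refine PolyTime.intro (.seq p' p)
    (((PolyBounded.self.eval q').add (hs.eval q)).add (.const 1)) fun x => ?_
  obtain ⟨t, h1, h2⟩ := hp (f x)
  obtain ⟨t', h1', h2'⟩ := hp' x
  exact ⟨_, .seq h1' h1, by omega⟩

theorem PolyTime.pair {f : α → β} {g : α → γ} (hf : PolyTime f) (hg : PolyTime g) :
    PolyTime fun x => (f x, g x) := by
  obtain ⟨p, q, hp⟩ := hf
  obtain ⟨p', q', hp'⟩ := hg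
  refine PolyTime.intro (.pair p p')
    (((PolyBounded.self.eval q).add (PolyBounded.self.eval q')).add (.const 1))
    fun x => ?_
  obtain ⟨t, h1, h2⟩ := hp x
  obtain ⟨t', h1', h2'⟩ := hp' x
  exact ⟨_, .pair h1 h1', by omega⟩

theorem PolyTime.ite {c : α → Bool} {f g : α → β} (hc : PolyTime c) (hf : PolyTime f)
    (hg : PolyTime g) : PolyTime fun x => if c x then f x else g x := by
  obtain ⟨p, q, hp⟩ := hc
  obtain ⟨p₁, q₁, hp₁⟩ := hf
  obtain ⟨p₂, q₂, hp₂⟩ := hg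
  refine PolyTime.intro (.cond p p₁ p₂)
    ((((PolyBounded.self.eval q).add (PolyBounded.self.eval q₁)).add
      (PolyBounded.self.eval q₂)).add (.const 1)) fun x => ?_
  obtain ⟨t, h1, h2⟩ := hp x
  obtain ⟨t₁, h1₁, h2₁⟩ := hp₁ x
  obtain ⟨t₂, h1₂, h2₂⟩ := hp₂ x
  cases hx : c x with
  | false =>
    rw [hx] at h1
    exact ⟨_, .cond_false h1 (by simpa using h1₂), by omega⟩
  | true =>
    rw [hx] at h1
    exact ⟨_, .cond_true h1 (by simpa using h1₁), by omega⟩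

theorem Data.exists_const_prog (d : Data) :
    ∃ (p : Prog) (c : ℕ), ∀ x, ∃ t, p.Runs x d t ∧ t ≤ c * (x.size + 1) := by
  induction d with
  | nil => exact ⟨.nil, 1, fun x => ⟨_, .nil x, by omega⟩⟩
  | cons a b iha ihb =>
    obtain ⟨p, c, hp⟩ := iha
    obtain ⟨p', c', hp'⟩ := ihb
    refine ⟨.pair p p', c + c' + 1, fun x => ?_⟩
    obtain ⟨t, h1, h2⟩ := hp x
    obtain ⟨t', h1', h2'⟩ := hp' x
    refine ⟨_, .pair h1 h1', ?_⟩
    rw [add_mul, add_mul]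
    omega

theorem PolyTime.const (y : β) : PolyTime fun _ : α => y := by
  obtain ⟨p, c, hp⟩ := (code y).exists_const_prog
  exact PolyTime.intro p ((PolyBounded.const c).mul (PolyBounded.self.add (.const 1)))
    fun x => hp (code x)

/-! ### Iteration over a list -/

/-- The loop state is the triple of context `X`, remaining list and accumulator. `Z` bounds the
state throughout the run. An iteration performs twelve projections on trees of size at most `Z`
besides the call of `p`, which `20 * (Z + 1)` covers. -/
theorem Prog.exists_runs_foldl {p : Prog} {q : Polynomial ℕ} (f : β → σ → σ) (X : Data)
    (hp : ∀ b s, ∃ t, p.Runs (.cons X (.cons (code b) (code s))) (code (f b s)) t ∧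
      t ≤ q.eval (X.size + codeSize b + codeSize s + 2))
    (Z : ℕ) (l : List β) (s : σ)
    (h : ∀ l', l' <+: l →
      X.size + codeSize l + codeSize (l'.foldl (fun s b => f b s) s) + 2 ≤ Z) :
    ∃ t, (Prog.loop (.seq .snd .fst) (.pair .fst (.pair (.seq .snd (.seq .fst .snd))
      (.seq (.pair .fst (.pair (.seq .snd (.seq .fst .fst)) (.seq .snd .snd))) p)))).Runs
        (.cons X (.cons (code l) (code s)))
        (.cons X (.cons .nil (code (l.foldl (fun s b => f b s) s)))) t ∧
      t ≤ (l.length + 1) * (20 * (Z + 1) + q.eval Z) := by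
  induction l generalizing s with
  | nil =>
    have h0 := h [] List.prefix_rfl
    refine ⟨_, Prog.Runs.loop_stop (.seq (.snd _) (.fst _)), ?_⟩
    simp only [Data.size, codeSize, code, encList, Data.snd, List.foldl_nil] at h0 ⊢
    simp only [List.length_nil]
    omega
  | cons b l ih =>
    have h0 := h [] (List.nil_prefix)
    have h0' := codeSize_cons b l
    obtain ⟨t, ht, htb⟩ := hp b s
    obtain ⟨u, hu, hub⟩ := ih (f b s) fun l' hl' => by
      have := h (b :: l') (by simpa using hl')
      rw [List.foldl_cons] at this
      omega
    refine ⟨_, .loop_step (a := code b) (b := code l) (.seq (.snd _) (.fst _))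
      (.pair (.fst _) (.pair (.seq (.snd _) (.seq (.fst _) (.snd _)))
        (.seq (.pair (.fst _) (.pair (.seq (.snd _) (.seq (.fst _) (.fst _)))
          (.seq (.snd _) (.snd _)))) ht))) hu, ?_⟩
    have hq : q.eval (X.size + codeSize b + codeSize s + 2) ≤ q.eval Z := by
      apply q.eval_nat_mono
      simp only [List.foldl_nil] at h0
      omega
    have hc : (code (b :: l)).size = (code b).size + (code l).size + 1 := rfl
    have hc' : code (b :: l) = .cons (code b) (code l) := rfl
    rw [List.length_cons, add_mul (l.length + 1), one_mul]
    simp only [hc', Data.size, codeSize, Data.snd, Data.fst, List.foldl_nil] at h0 hc ⊢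
    omega

/-- The bound on all intermediate accumulators is essential: a polynomial-time step that doubles its
argument yields exponential size when iterated. -/
theorem PolyTime.foldl {l : α → List β} {init : α → σ} {f : α → β → σ → σ}
    (hl : PolyTime l) (hi : PolyTime init)
    (hf : PolyTime fun p : α × β × σ => f p.1 p.2.1 p.2.2) {g : α → ℕ} (hg : PolyBounded g)
    (hb : ∀ x l', l' <+: l x →
      codeSize (l'.foldl (fun s b => f x b s) (init x)) ≤ g x) :
    PolyTime fun x => (l x).foldl (fun s b => f x b s) (init x) := by
  have hl' := hl.bounded_codeSize
  have hs := (PolyTime.pair PolyTime.id (hl.pair hi))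
  obtain ⟨p, q, hp⟩ := hf
  obtain ⟨r, w, hr⟩ := hs
  have hZ : PolyBounded fun x : α =>
      codeSize x + codeSize (l x) + g x + 2 :=
    ((PolyBounded.self.add hl').add hg).add (.const 2)
  refine PolyTime.intro (.seq (.seq r (.loop (.seq .snd .fst) (.pair .fst (.pair
      (.seq .snd (.seq .fst .snd)) (.seq (.pair .fst (.pair (.seq .snd (.seq .fst .fst))
        (.seq .snd .snd))) p))))) (.seq .snd .snd))
    (((PolyBounded.self.eval w).add ((hl'.add (.const 1)).mul
      ((PolyBounded.mul (.const 20) (hZ.add (.const 1))).add (hZ.eval q)))).add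
      (((PolyBounded.mul (.const 2) hZ)).add (.const 10)))
    fun x => ?_
  obtain ⟨t, h1, h2⟩ := hr x
  obtain ⟨u, hu, hub⟩ := Prog.exists_runs_foldl (p := p) (q := q) (f x) (code x)
    (fun b s => by
      obtain ⟨t, h1, h2⟩ := hp (x, b, s)
      refine ⟨t, h1, h2.trans (le_of_eq ?_)⟩
      congr 1
      simp only [codeSize_mk]
      unfold codeSize
      omega)
    (codeSize x + codeSize (l x) + g x + 2) (l x) (init x) (fun l' h' => by
      have := hb x l' h'
      have h3 : (code x).size = codeSize x := rfl
      omega)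
  refine ⟨_, .seq (.seq h1 hu) (.seq (.snd _) (.snd _)), ?_⟩
  have hle : ((l x).length + 1) * (20 * (codeSize x + codeSize (l x) + g x + 2 + 1)
      + q.eval (codeSize x + codeSize (l x) + g x + 2)) ≤
      (codeSize (l x) + 1) * (20 * (codeSize x + codeSize (l x) + g x + 2 + 1)
      + q.eval (codeSize x + codeSize (l x) + g x + 2)) :=
    Nat.mul_le_mul_right _ (by have := length_le_codeSize (l x); omega)
  have hx := hb x (l x) List.prefix_rfl
  have h3 : (code x).size = codeSize x := rfl
  have h4 : (code ((l x).foldl (fun s b => f x b s) (init x))).size =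
    codeSize ((l x).foldl (fun s b => f x b s) (init x)) := rfl
  simp only [Data.size, Data.snd]
  omega

end

section

variable {α β γ σ : Type} [TreeCode α] [TreeCode β] [TreeCode γ] [TreeCode σ]

/-! ### Lists -/

theorem codeSize_append (l l' : List α) :
    codeSize (l ++ l') + 1 = codeSize l + codeSize l' := by
  induction l with
  | nil => rw [List.nil_append, codeSize_nil]; omega
  | cons a l ih => rw [List.cons_append, codeSize_cons, codeSize_cons]; omega

theorem codeSize_reverse (l : List α) : codeSize l.reverse = codeSize l := by
  induction l with
  | nil => rfl
  | cons a l ih =>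
    have := codeSize_append l.reverse [a]
    rw [List.reverse_cons]
    rw [codeSize_cons, codeSize_nil] at this
    rw [codeSize_cons]
    omega

theorem codeSize_le_of_suffix {l l' : List α} (h : l' <:+ l) : codeSize l' ≤ codeSize l := by
  obtain ⟨t, rfl⟩ := h
  have := codeSize_append t l'
  have := codeSize_pos t
  omega

theorem codeSize_le_of_prefix {l l' : List α} (h : l' <+: l) : codeSize l' ≤ codeSize l := by
  obtain ⟨t, rfl⟩ := h
  have := codeSize_append l' t
  have := codeSize_pos t
  omega

theorem PolyTime.cons {f : α → β} {l : α → List β} (hf : PolyTime f) (hl : PolyTime l) :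
    PolyTime fun x => f x :: l x :=
  (hf.pair hl).recode fun _ => rfl

theorem PolyTime.reverse {l : α → List β} (hl : PolyTime l) :
    PolyTime fun x => (l x).reverse := by
  refine (PolyTime.foldl (f := fun _ b s => b :: s) hl (.const [])
    (.cons (PolyTime.fst.comp .snd) (PolyTime.snd.comp .snd)) hl.bounded_codeSize ?_).congr ?_
  · intro x l' h
    rw [List.foldl_flip_cons_eq_append, List.append_nil, codeSize_reverse, List.map_id']
    exact codeSize_le_of_prefix h
  · intro x
    rw [List.foldl_flip_cons_eq_append, List.append_nil, List.map_id']

/-- A right fold is a left fold over the reversed list, so its intermediate values belong to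
suffixes. -/
theorem PolyTime.foldr {l : α → List β} {init : α → σ} {f : α → β → σ → σ}
    (hl : PolyTime l) (hi : PolyTime init)
    (hf : PolyTime fun p : α × β × σ => f p.1 p.2.1 p.2.2) {g : α → ℕ} (hg : PolyBounded g)
    (hb : ∀ x l', l' <:+ l x → codeSize (l'.foldr (f x) (init x)) ≤ g x) :
    PolyTime fun x => (l x).foldr (f x) (init x) := by
  refine (PolyTime.foldl hl.reverse hi hf hg ?_).congr fun x => ?_
  · intro x l' h
    have := hb x l'.reverse (by simpa using List.reverse_suffix.2 h)
    simpa [List.foldr_reverse] using this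
  · rw [List.foldl_reverse]

theorem PolyTime.append {l l' : α → List β} (hl : PolyTime l) (hl' : PolyTime l') :
    PolyTime fun x => l x ++ l' x := by
  refine (PolyTime.foldr (f := fun _ b s => b :: s) hl hl'
    (.cons (PolyTime.fst.comp .snd) (PolyTime.snd.comp .snd))
    (hl.bounded_codeSize.add hl'.bounded_codeSize) ?_).congr ?_
  · intro x l'' h
    rw [List.foldr_cons_eq_append']
    have := codeSize_append l'' (l' x)
    have := codeSize_le_of_suffix h
    omega
  · intro x
    rw [List.foldr_cons_eq_append']

theorem PolyTime.map {l : α → List β} {f : α → β → γ} (hl : PolyTime l)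
    (hf : PolyTime fun p : α × β => f p.1 p.2) : PolyTime fun x => (l x).map (f x) := by
  obtain ⟨q, hq⟩ := hf.bounded_codeSize
  refine (PolyTime.foldr (f := fun x b s => f x b :: s) hl (.const [])
    (.cons (hf.comp (PolyTime.fst.pair (PolyTime.fst.comp .snd))) (PolyTime.snd.comp .snd))
    ((hl.bounded_codeSize.mul ((((PolyBounded.self.add hl.bounded_codeSize).add
      (.const 1)).eval q).add (.const 1))).add (.const 1)) ?_).congr ?_
  · intro x l' h
    rw [← List.map_eq_foldr]
    refine (codeSize_list_le (B := q.eval (codeSize x + codeSize (l x) + 1))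
      fun c hc => ?_).trans ?_
    · obtain ⟨b, hb, rfl⟩ := List.mem_map.1 hc
      refine (hq (x, b)).trans (q.eval_nat_mono ?_)
      rw [codeSize_mk]
      have := codeSize_le_of_mem (h.subset hb)
      omega
    · have h1 := length_le_codeSize (l x)
      have h2 := h.length_le
      rw [List.length_map]
      exact Nat.add_le_add_right (Nat.mul_le_mul_right _ (h2.trans h1)) _
  · intro x
    rw [← List.map_eq_foldr]

theorem codeSize_le_of_sublist {l l' : List α} (h : l'.Sublist l) :
    codeSize l' ≤ codeSize l := by
  induction h with
  | slnil => exact le_rfl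
  | cons a _ ih => rw [codeSize_cons]; omega
  | cons_cons a _ ih => rw [codeSize_cons, codeSize_cons]; omega

theorem PolyTime.filter {l : α → List β} {f : α → β → Bool} (hl : PolyTime l)
    (hf : PolyTime fun p : α × β => f p.1 p.2) : PolyTime fun x => (l x).filter (f x) := by
  have key (x : α) (l' : List β) :
      l'.foldr (fun b s => if f x b then b :: s else s) [] = l'.filter (f x) := by
    induction l' with
    | nil => rfl
    | cons b l' ih => rw [List.foldr_cons, ih, List.filter_cons]
  refine (PolyTime.foldr (f := fun x b s => if f x b then b :: s else s) hl (.const [])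
    (.ite (hf.comp (PolyTime.fst.pair (PolyTime.fst.comp .snd)))
      (.cons (PolyTime.fst.comp .snd) (PolyTime.snd.comp .snd)) (PolyTime.snd.comp .snd))
    hl.bounded_codeSize ?_).congr ?_
  · intro x l' h
    rw [key]
    exact (codeSize_le_of_sublist List.filter_sublist).trans (codeSize_le_of_suffix h)
  · intro x
    rw [key]

theorem PolyTime.tail {l : α → List β} (hl : PolyTime l) : PolyTime fun x => (l x).tail := by
  refine PolyTime.comp (g := List.tail) ?_ hl
  refine PolyTime.intro .snd (PolyBounded.self.add (.const 1)) fun l => ⟨_, ?_, le_rfl⟩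
  have : code l.tail = (code l).snd := by cases l <;> rfl
  rw [this]
  exact .snd _

theorem PolyTime.isEmpty {l : α → List β} (hl : PolyTime l) :
    PolyTime fun x => (l x).isEmpty := by
  refine PolyTime.comp (g := List.isEmpty) ?_ hl
  refine PolyTime.intro (.cond .id .nil (.pair .nil .nil))
    (PolyBounded.mul (.const 6) (PolyBounded.self.add (.const 1))) fun l => ?_
  cases l with
  | nil =>
    refine ⟨_, .cond_false (.id _) (.pair (.nil _) (.nil _)), ?_⟩
    simp only [codeSize]
    omega
  | cons b l =>
    refine ⟨_, .cond_true (.id _) (.nil _), ?_⟩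
    simp only [codeSize, code, encList]
    omega

theorem PolyTime.headD {l : α → List β} (hl : PolyTime l) (d : β) :
    PolyTime fun x => (l x).headD d := by
  refine PolyTime.comp (g := fun l : List β => l.headD d) ?_ hl
  obtain ⟨p, c, hp⟩ := (code d).exists_const_prog
  refine PolyTime.intro (.cond .id .fst p)
    (PolyBounded.mul (.const (c + 3)) (PolyBounded.self.add (.const 1))) fun l => ?_
  cases l with
  | nil =>
    obtain ⟨t, h1, h2⟩ := hp (code ([] : List β))
    refine ⟨_, .cond_false (.id _) h1, ?_⟩
    simp only [codeSize, add_mul] at h2 ⊢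
    omega
  | cons b l =>
    refine ⟨_, .cond_true (.id _) (.fst _), ?_⟩
    rw [add_mul]
    simp only [codeSize, code, encList]
    omega

/-! ### Truth values -/

theorem PolyTime.not {f : α → Bool} (hf : PolyTime f) : PolyTime fun x => !f x :=
  (PolyTime.ite hf (.const false) (.const true)).congr fun x => by cases f x <;> rfl

theorem PolyTime.and {f g : α → Bool} (hf : PolyTime f) (hg : PolyTime g) :
    PolyTime fun x => f x && g x :=
  (PolyTime.ite hf hg (.const false)).congr fun x => by cases f x <;> rfl

theorem PolyTime.xor {f g : α → Bool} (hf : PolyTime f) (hg : PolyTime g) :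
    PolyTime fun x => f x ^^ g x :=
  (PolyTime.ite hf hg.not hg).congr fun x => by cases f x <;> simp

/-! ### Natural numbers in unary -/

/-- A unary number and a list of `nil`s are the same tree, so list operations serve as arithmetic:
`tail` is the predecessor and `isEmpty` the test for zero. -/
theorem code_replicate_nil (k : ℕ) : code (List.replicate k Data.nil) = code k := by
  induction k with
  | zero => rfl
  | succ k ih => rw [code_nat_succ, ← ih]; rfl

theorem PolyTime.succ {f : α → ℕ} (hf : PolyTime f) : PolyTime fun x => f x + 1 :=
  (PolyTime.pair (.const Data.nil) hf).recode fun _ => rfl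

/-- Iteration with a counter in unary. -/
theorem PolyTime.iterate (F : α → ℕ → σ) {T : α → ℕ} {f : α → σ → σ} (hT : PolyTime T)
    (h0 : PolyTime fun x => F x 0) (hf : PolyTime fun p : α × σ => f p.1 p.2)
    (hF : ∀ x i, i < T x → f x (F x i) = F x (i + 1)) {g : α → ℕ} (hg : PolyBounded g)
    (hb : ∀ x i, i ≤ T x → codeSize (F x i) ≤ g x) : PolyTime fun x => F x (T x) := by
  have key (x : α) (i : ℕ) (hi : i ≤ T x) :
      (List.replicate i Data.nil).foldl (fun s _ => f x s) (F x 0) = F x i := by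
    induction i with
    | zero => rfl
    | succ i ih =>
      rw [List.replicate_succ', List.foldl_append, ih (by omega)]
      exact hF x i (by omega)
  refine (PolyTime.foldl (l := fun x => List.replicate (T x) Data.nil) (f := fun x _ s => f x s)
    (hT.recode fun x => (code_replicate_nil _).symm) h0
    (hf.comp (PolyTime.fst.pair (PolyTime.snd.comp .snd))) hg ?_).congr fun x => key x _ le_rfl
  intro x l' h
  obtain ⟨h1, h2⟩ := List.prefix_replicate_iff.1 h
  rw [h2, key x _ h1]
  exact hb x _ h1

theorem PolyTime.length {l : α → List β} (hl : PolyTime l) : PolyTime fun x => (l x).length := by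
  refine (PolyTime.foldr (f := fun _ _ s => s + 1) hl (.const 0)
    (PolyTime.succ (PolyTime.snd.comp .snd)) (PolyBounded.mul (.const 2) hl.bounded_codeSize |>.add
      (.const 1)) ?_).congr fun x => ?_
  · intro x l' h
    rw [List.foldr_const, codeSize_nat]
    have h1 := length_le_codeSize (l x)
    have h2 := h.length_le
    simp
    omega
  · simp [List.foldr_const]

theorem PolyTime.natAdd {f g : α → ℕ} (hf : PolyTime f) (hg : PolyTime g) :
    PolyTime fun x => f x + g x :=
  PolyTime.iterate (fun x i => f x + i) (f := fun _ s => s + 1) hg hf (PolyTime.succ .snd)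
    (fun _ _ _ => rfl) ((PolyBounded.mul (.const 2) (hf.bounded.add hg.bounded)).add (.const 1))
    fun x i hi => by rw [codeSize_nat]; omega

theorem PolyTime.natMul {f g : α → ℕ} (hf : PolyTime f) (hg : PolyTime g) :
    PolyTime fun x => f x * g x :=
  PolyTime.iterate (fun x i => f x * i) (f := fun x s => s + f x) hg (.const 0)
    (PolyTime.natAdd .snd (hf.comp .fst)) (fun _ _ _ => (Nat.mul_succ _ _).symm)
    ((PolyBounded.mul (.const 2) (hf.bounded.mul hg.bounded)).add (.const 1))
    fun x i hi => by
      rw [codeSize_nat]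
      have := Nat.mul_le_mul_left (f x) hi
      omega

theorem PolyTime.pred {f : α → ℕ} (hf : PolyTime f) : PolyTime fun x => f x - 1 :=
  (PolyTime.tail (hf.recode (g := fun x => List.replicate (f x) Data.nil)
    fun _ => (code_replicate_nil _).symm)).recode fun x => by
      rw [List.tail_replicate, code_replicate_nil]

theorem PolyTime.natSub {f g : α → ℕ} (hf : PolyTime f) (hg : PolyTime g) :
    PolyTime fun x => f x - g x :=
  PolyTime.iterate (fun x i => f x - i) (f := fun _ s => s - 1) hg hf (PolyTime.pred .snd)
    (fun _ _ _ => rfl) ((PolyBounded.mul (.const 2) hf.bounded).add (.const 1))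
    fun x i hi => by rw [codeSize_nat]; omega

theorem PolyTime.natLe {f g : α → ℕ} (hf : PolyTime f) (hg : PolyTime g) :
    PolyTime fun x => decide (f x ≤ g x) :=
  (PolyTime.isEmpty ((hf.natSub hg).recode (g := fun x => List.replicate (f x - g x) Data.nil)
    fun _ => (code_replicate_nil _).symm)).congr fun x => by
      rw [Bool.eq_iff_iff]
      simp only [List.isEmpty_iff, List.replicate_eq_nil_iff, decide_eq_true_eq]
      omega

theorem PolyTime.natLt {f g : α → ℕ} (hf : PolyTime f) (hg : PolyTime g) :
    PolyTime fun x => decide (f x < g x) :=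
  hf.succ.natLe hg

theorem PolyTime.natEq {f g : α → ℕ} (hf : PolyTime f) (hg : PolyTime g) :
    PolyTime fun x => decide (f x = g x) :=
  ((hf.natLe hg).and (hg.natLe hf)).congr fun x => by
    rw [Bool.eq_iff_iff]
    simp only [Bool.and_eq_true, decide_eq_true_eq]
    omega

theorem PolyTime.natMax {f g : α → ℕ} (hf : PolyTime f) (hg : PolyTime g) :
    PolyTime fun x => max (f x) (g x) :=
  (hf.natAdd (hg.natSub hf)).congr fun x => by omega

theorem PolyTime.range {f : α → ℕ} (hf : PolyTime f) : PolyTime fun x => List.range (f x) := by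
  have h (k : ℕ) : (List.range (k + 1)).reverse = k :: (List.range k).reverse := by
    simp [List.range_succ]
  have : PolyTime fun x => (f x, (List.range (f x)).reverse) := by
    refine PolyTime.iterate (fun x i => (i, (List.range i).reverse))
      (f := fun _ s => (s.1 + 1, s.1 :: s.2)) hf (.const _)
      (PolyTime.pair (PolyTime.succ (PolyTime.fst.comp .snd))
        (PolyTime.cons (PolyTime.fst.comp .snd) (PolyTime.snd.comp .snd)))
      (fun x i _ => by rw [h])
      (g := fun x => (2 * f x + 1) + (f x * ((2 * f x + 1) + 1) + 1) + 1)
      (by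
        have h1 := (PolyBounded.mul (.const 2) hf.bounded).add (.const 1)
        exact (h1.add ((hf.bounded.mul (h1.add (.const 1))).add (.const 1))).add (.const 1)) ?_
    intro x i hi
    rw [codeSize_mk, codeSize_nat, codeSize_reverse]
    have h1 := codeSize_list_le (l := List.range i) (B := 2 * f x + 1) fun a ha => by
      rw [codeSize_nat]
      have := List.mem_range.1 ha
      omega
    have h2 : (List.range i).length * ((2 * f x + 1) + 1) ≤ f x * ((2 * f x + 1) + 1) := by
      rw [List.length_range]
      exact Nat.mul_le_mul_right _ hi
    omega
  exact ((PolyTime.snd.comp this).reverse).congr fun x => List.reverse_reverse _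

/-! ### Parts of lists -/

theorem PolyTime.drop {l : α → List β} {f : α → ℕ} (hf : PolyTime f) (hl : PolyTime l) :
    PolyTime fun x => (l x).drop (f x) :=
  PolyTime.iterate (fun x i => (l x).drop i) (f := fun _ s => s.tail) hf hl (PolyTime.tail .snd)
    (fun _ _ _ => List.tail_drop) hl.bounded_codeSize
    fun _ _ _ => codeSize_le_of_suffix (List.drop_suffix _ _)

theorem PolyTime.take {l : α → List β} {f : α → ℕ} (hf : PolyTime f) (hl : PolyTime l) :
    PolyTime fun x => (l x).take (f x) :=
  (PolyTime.reverse (PolyTime.drop (hl.length.natSub hf) hl.reverse)).congr fun x => by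
    rw [List.reverse_drop]
    simp only [List.reverse_reverse, List.length_reverse]
    rcases le_total (f x) (l x).length with h | h
    · rw [Nat.sub_sub_self h]
    · rw [Nat.sub_eq_zero_of_le h, Nat.sub_zero, List.take_of_length_le le_rfl,
        List.take_of_length_le h]

theorem PolyTime.getD {l : α → List β} {f : α → ℕ} (hl : PolyTime l) (hf : PolyTime f) (d : β) :
    PolyTime fun x => (l x).getD (f x) d :=
  ((hf.drop hl).headD d).congr fun x => by
    rw [List.getD_eq_getElem?_getD, List.headD_eq_head?_getD, List.head?_drop]

theorem PolyTime.contains {l : α → List ℕ} {f : α → ℕ} (hl : PolyTime l) (hf : PolyTime f) :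
    PolyTime fun x => decide (f x ∈ l x) :=
  ((hl.filter (f := fun x b => decide (f x = b))
    ((hf.comp .fst).natEq .snd)).isEmpty.not).congr fun x => by
      rw [Bool.eq_iff_iff]
      simp [List.filter_eq_nil_iff]

theorem PolyTime.foldr_max {l : α → List ℕ} (hl : PolyTime l) :
    PolyTime fun x => (l x).foldr max 0 := by
  refine PolyTime.foldr (f := fun _ b s => max b s) hl (.const 0)
    (PolyTime.natMax (PolyTime.fst.comp .snd) (PolyTime.snd.comp .snd)) hl.bounded_codeSize ?_
  intro x l' h
  refine le_trans ?_ (codeSize_le_of_suffix h)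
  clear h
  induction l' with
  | nil => simp [codeSize_nat, codeSize_nil]
  | cons b l' ih =>
    rw [List.foldr_cons, codeSize_cons, codeSize_nat]
    rw [codeSize_nat] at ih
    rw [codeSize_nat]
    omega

end

/-! ### Binary numbers -/

/-- The binary number `l` plus the carry `c`, least significant bit first. -/
def incBits : Bool → List Bool → List Bool
  | c, [] => if c then [true] else []
  | c, b :: l => (c ^^ b) :: incBits (c && b) l

theorem incBits_false (l : List Bool) : incBits false l = l := by
  induction l with
  | nil => rfl
  | cons b l ih => simp [incBits, ih]

theorem incBits_true_bits (k : ℕ) : incBits true k.bits = (k + 1).bits := by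
  induction k using Nat.binaryRec' with
  | zero => simp [incBits]
  | bit b k h ih =>
    rw [Nat.bits_append_bit k b h]
    cases b with
    | false =>
      rw [incBits, Bool.true_and, incBits_false]
      simp only [Nat.bit_false, Bool.xor_false]
      rw [Nat.bit1_bits]
    | true =>
      rw [incBits, Bool.true_and, ih]
      simp only [Nat.bit_true, Bool.xor_true, Bool.not_true]
      rw [show 2 * k + 1 + 1 = 2 * (k + 1) by ring, Nat.bit0_bits _ (by omega)]

section

variable {α β σ : Type} [TreeCode α] [TreeCode β] [TreeCode σ]

theorem codeSize_bools_le (l : List Bool) : codeSize l ≤ 4 * l.length + 1 := by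
  have := codeSize_list_le (l := l) (B := 3) fun b _ => codeSize_bool_le b
  omega

theorem PolyTime.incBits {l : α → List Bool} (hl : PolyTime l) :
    PolyTime fun x => incBits true (l x) := by
  have hlen (l' : List Bool) (s : Bool × List Bool) :
      (l'.foldl (fun s b => (s.1 && b, (s.1 ^^ b) :: s.2)) s).2.length =
        l'.length + s.2.length := by
    induction l' generalizing s with
    | nil => simp
    | cons b l' ih => rw [List.foldl_cons, ih]; simp only [List.length_cons]; omega
  -- Invariant of the fold: its state is the current carry and the bits produced so far, most recent
  -- first; a final carry becomes the top bit.
  have key (l' : List Bool) (s : Bool × List Bool) :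
      (let r := l'.foldl (fun s b => (s.1 && b, (s.1 ^^ b) :: s.2)) s
       if r.1 then true :: r.2 else r.2).reverse = s.2.reverse ++ _root_.incBits s.1 l' := by
    induction l' generalizing s with
    | nil => rcases s with ⟨_ | _, s⟩ <;> simp [_root_.incBits]
    | cons b l' ih => rw [List.foldl_cons, ih]; simp [_root_.incBits]
  have h : PolyTime fun x => (l x).foldl (fun s b => (s.1 && b, (s.1 ^^ b) :: s.2))
      ((true, []) : Bool × List Bool) := by
    have h1 : PolyTime fun p : α × Bool × Bool × List Bool => p.2.2.1 :=
      PolyTime.fst.comp (PolyTime.snd.comp .snd)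
    have h2 : PolyTime fun p : α × Bool × Bool × List Bool => p.2.1 := PolyTime.fst.comp .snd
    refine PolyTime.foldl (f := fun _ b s => (s.1 && b, (s.1 ^^ b) :: s.2)) hl (.const _)
      ((h1.and h2).pair ((h1.xor h2).cons (PolyTime.snd.comp (PolyTime.snd.comp .snd))))
      ((PolyBounded.mul (.const 4) hl.bounded_codeSize).add (.const 5)) ?_
    intro x l' h
    have h1 := hlen l' (true, [])
    have h2 := codeSize_bools_le (l'.foldl (fun s b => (s.1 && b, (s.1 ^^ b) :: s.2))
      ((true, []) : Bool × List Bool)).2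
    have h3 := codeSize_bool_le (l'.foldl (fun s b => (s.1 && b, (s.1 ^^ b) :: s.2))
      ((true, []) : Bool × List Bool)).1
    have h4 := h.length_le
    have h5 := length_le_codeSize (l x)
    simp only [List.length_nil] at h1
    rw [← Prod.mk.eta (p := List.foldl _ _ _), codeSize_mk]
    omega
  refine (PolyTime.reverse (PolyTime.ite (PolyTime.fst.comp h)
    (PolyTime.cons (.const true) (PolyTime.snd.comp h)) (PolyTime.snd.comp h))).congr fun x => ?_
  exact key (l x) (true, [])

/-- The binary form is reached by incrementing from zero; as the argument is unary, the number of
increments is polynomial. -/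
theorem PolyTime.natBits {f : α → ℕ} (hf : PolyTime f) : PolyTime fun x => (f x).bits :=
  PolyTime.iterate (fun _ i => i.bits) (f := fun _ s => _root_.incBits true s) hf (.const _)
    (PolyTime.incBits .snd) (fun _ i _ => incBits_true_bits i)
    ((PolyBounded.mul (.const 4) hf.bounded).add (.const 1)) fun x i hi => by
      refine (codeSize_bools_le _).trans ?_
      rw [Nat.size_eq_bits_len]
      have : i.size ≤ i := Nat.size_le.2 Nat.lt_two_pow_self
      omega

/-- Conversion from binary to unary of a number with a known bound. -/
theorem PolyTime.ofBits {f B : α → ℕ} (hf : PolyTime fun x => (f x).bits) (hB : PolyTime B)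
    (h : ∀ x, f x ≤ B x) : PolyTime f := by
  -- `d - (d - K)` is `min d K`. The truncation bounds every accumulator of Horner's scheme by `K`
  -- and never acts on the digits of a number `k ≤ K`.
  have key (K k : ℕ) (hk : k ≤ K) :
      k.bits.foldr (fun b s => (s + s + if b then 1 else 0) -
        ((s + s + if b then 1 else 0) - K)) 0 = k := by
    induction k using Nat.binaryRec' with
    | zero => simp
    | bit b k h ih =>
      have h2 : Nat.bit b k = k + k + if b then 1 else 0 := by
        cases b <;> simp [Nat.bit] <;> ring
      rw [Nat.bits_append_bit k b h, List.foldr_cons, ih (by omega), ← h2]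
      omega
  have hd : PolyTime fun p : α × Bool × ℕ => p.2.2 + p.2.2 + if p.2.1 then 1 else 0 :=
    ((PolyTime.snd.comp .snd).natAdd (PolyTime.snd.comp .snd)).natAdd
      (PolyTime.ite (PolyTime.fst.comp .snd) (.const 1) (.const 0))
  refine (PolyTime.foldr (f := fun x b s => (s + s + if b then 1 else 0) -
        ((s + s + if b then 1 else 0) - B x)) hf (.const 0)
    (hd.natSub (hd.natSub (hB.comp .fst)))
    ((PolyBounded.mul (.const 2) hB.bounded).add (.const 1)) ?_).congr fun x => key _ _ (h x)
  intro x l' _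
  rw [codeSize_nat]
  cases l' with
  | nil => simp
  | cons b l' =>
    rw [List.foldr_cons]
    omega

/-! ### Search -/

/-- The least number below `T` with the property `p`, or `0`. -/
def leastBelow (p : ℕ → Bool) (T : ℕ) : ℕ :=
  (List.range T).foldr (fun m s => if p m then m else s) 0

theorem leastBelow_spec {p : ℕ → Bool} {T m : ℕ} (hm : m < T) (hp : p m) :
    p (leastBelow p T) ∧ leastBelow p T ≤ m := by
  unfold leastBelow
  -- Splitting off the last candidate `T` changes the default value of the fold, so the induction
  -- needs an arbitrary default.
  generalize (0 : ℕ) = d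
  induction T generalizing d with
  | zero => omega
  | succ T ih =>
    rw [List.range_succ, List.foldr_append]
    by_cases h : m < T
    · exact ih h _
    · obtain rfl : m = T := by omega
      simp only [List.foldr_cons, List.foldr_nil, hp, if_true]
      clear ih hm h
      have : ∀ l : List ℕ, (∀ i ∈ l, i < m) →
          p (l.foldr (fun m s => if p m then m else s) m) ∧
            l.foldr (fun m s => if p m then m else s) m ≤ m := by
        intro l hl
        induction l with
        | nil => exact ⟨hp, le_rfl⟩
        | cons i l ih =>
          rw [List.foldr_cons]
          split_ifs with h
          · exact ⟨h, (hl i List.mem_cons_self).le⟩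
          · exact ih fun j hj => hl j (List.mem_cons_of_mem _ hj)
      exact this _ fun i hi => List.mem_range.1 hi

theorem PolyTime.leastBelow {p : α → ℕ → Bool} {T : α → ℕ}
    (hp : PolyTime fun x : α × ℕ => p x.1 x.2) (hT : PolyTime T) :
    PolyTime fun x => leastBelow (p x) (T x) := by
  refine PolyTime.foldr (f := fun x m s => if p x m then m else s) hT.range (.const 0)
    (PolyTime.ite (hp.comp (PolyTime.fst.pair (PolyTime.fst.comp .snd)))
      (PolyTime.fst.comp .snd) (PolyTime.snd.comp .snd))
    ((PolyBounded.mul (.const 2) hT.bounded).add (.const 1)) ?_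
  intro x l' h
  have h1 : ∀ i ∈ l', i ≤ T x := fun i hi => (List.mem_range.1 (h.subset hi)).le
  clear h
  induction l' with
  | nil => simp [codeSize_nat]
  | cons i l' ih =>
    rw [List.foldr_cons]
    split_ifs
    · rw [codeSize_nat]
      have := h1 i List.mem_cons_self
      omega
    · exact ih fun j hj => h1 j (List.mem_cons_of_mem _ hj)

end

/-! ### Counting edges -/

section

variable {n : ℕ} (G : SimpleGraph (Fin n))

open Classical in
-- Double counting: an edge contributes to the degree sum its number of endpoints in `U`. The first
-- such endpoint is accounted for by `touchCount`, the second by `internalCount`.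
theorem touchCount_add_internalCount (U : Finset (Fin n)) :
    touchCount G U + internalCount G U = ∑ v ∈ U, G.degree v := by
  have h1 : touchCount G U =
      ∑ e ∈ G.edgeFinset, if ∃ v ∈ e, v ∈ U then 1 else 0 := by
    rw [← Finset.card_filter, touchCount, ← Set.ncard_coe_finset]
    congr 1
    ext e
    simp
  have h2 : internalCount G U =
      ∑ e ∈ G.edgeFinset, if ∀ v ∈ e, v ∈ U then 1 else 0 := by
    rw [← Finset.card_filter, internalCount, ← Set.ncard_coe_finset]
    congr 1
    ext e
    simp
  have h3 (v : Fin n) : G.degree v = ∑ e ∈ G.edgeFinset, if v ∈ e then 1 else 0 := by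
    rw [← SimpleGraph.card_incidenceFinset_eq_degree, SimpleGraph.incidenceFinset_eq_filter,
      Finset.card_filter]
  rw [h1, h2, ← Finset.sum_add_distrib, Finset.sum_congr rfl fun v _ => h3 v, Finset.sum_comm]
  refine Finset.sum_congr rfl fun e he => ?_
  induction e with
  | _ a b =>
    have hab : a ≠ b := by
      rw [SimpleGraph.mem_edgeFinset] at he
      exact G.ne_of_adj he
    have h4 (v : Fin n) : (if v ∈ s(a, b) then 1 else 0) =
        (if v = a then 1 else 0) + (if v = b then 1 else 0 : ℕ) := by
      by_cases ha : v = a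
      · subst ha; simp [hab]
      · simp [ha]
    rw [Finset.sum_congr rfl fun v _ => h4 v, Finset.sum_add_distrib, Finset.sum_ite_eq',
      Finset.sum_ite_eq']
    by_cases ha : a ∈ U <;> by_cases hb : b ∈ U <;> simp [ha, hb]

theorem touchCount_mono {U W : Finset (Fin n)} (h : U ⊆ W) : touchCount G U ≤ touchCount G W :=
  Set.ncard_le_ncard (fun _ he => ⟨he.1, he.2.imp fun _ hv => ⟨hv.1, h hv.2⟩⟩) (Set.toFinite _)

theorem internalCount_mono {U W : Finset (Fin n)} (h : U ⊆ W) :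
    internalCount G U ≤ internalCount G W :=
  Set.ncard_le_ncard (fun _ he => ⟨he.1, fun v hv => h (he.2 v hv)⟩) (Set.toFinite _)

theorem internalCount_le_touchCount (U : Finset (Fin n)) :
    internalCount G U ≤ touchCount G U := by
  refine Set.ncard_le_ncard (fun e he => ⟨he.1, ?_⟩) (Set.toFinite _)
  induction e with
  | _ a b => exact ⟨a, by simp, he.2 a (by simp)⟩

theorem internalCount_singleton (v : Fin n) : internalCount G {v} = 0 := by
  rw [internalCount, Set.ncard_eq_zero (Set.toFinite _), Set.eq_empty_iff_forall_notMem]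
  rintro e ⟨he, h⟩
  induction e with
  | _ a b =>
    have ha := h a (by simp)
    have hb := h b (by simp)
    rw [Finset.mem_singleton] at ha hb
    exact G.ne_of_adj he (ha.trans hb.symm)

open Classical in
theorem degree_le_touchCount {U : Finset (Fin n)} {v : Fin n} (hv : v ∈ U) :
    G.degree v ≤ touchCount G U := by
  have h1 := touchCount_add_internalCount G {v}
  have h2 := touchCount_mono G (Finset.singleton_subset_iff.2 hv)
  rw [internalCount_singleton, Finset.sum_singleton] at h1
  omega

/-! ### Making all degrees equal -/

open Classical in
/-- The graph `G` together with a clique on `M` new vertices, where every vertex `i` of `G` is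
joined to as many vertices of the clique as its degree is short of the maximum degree. -/
noncomputable def equalized (M : ℕ) : SimpleGraph (Fin (n + M)) where
  Adj u v := Fin.addCases (motive := fun _ => Prop)
    (fun i => Fin.addCases (motive := fun _ => Prop) (fun j => G.Adj i j)
      (fun j => (j : ℕ) + G.degree i < G.maxDegree) v)
    (fun i => Fin.addCases (motive := fun _ => Prop)
      (fun j => (i : ℕ) + G.degree j < G.maxDegree) (fun j => i ≠ j) v) u
  symm := ⟨by
    intro u v
    induction u using Fin.addCases <;> induction v using Fin.addCases <;>
      simp [G.adj_comm, eq_comm]⟩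
  loopless := ⟨by
    intro u
    induction u using Fin.addCases <;> simp⟩

variable (M : ℕ)

theorem equalized_adj_castAdd_castAdd (i j : Fin n) :
    (equalized G M).Adj (Fin.castAdd M i) (Fin.castAdd M j) ↔ G.Adj i j := by
  simp [equalized]

open Classical in
theorem equalized_adj_castAdd_natAdd (i : Fin n) (j : Fin M) :
    (equalized G M).Adj (Fin.castAdd M i) (Fin.natAdd n j) ↔
      (j : ℕ) + G.degree i < G.maxDegree := by
  simp [equalized]

open Classical in
theorem equalized_adj_natAdd_castAdd (i : Fin M) (j : Fin n) :
    (equalized G M).Adj (Fin.natAdd n i) (Fin.castAdd M j) ↔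
      (i : ℕ) + G.degree j < G.maxDegree := by
  simp [equalized]

theorem equalized_adj_natAdd_natAdd (i j : Fin M) :
    (equalized G M).Adj (Fin.natAdd n i) (Fin.natAdd n j) ↔ i ≠ j := by
  simp [equalized]

open Classical in
theorem SimpleGraph.degree_eq_sum {V : Type*} [Fintype V] (H : SimpleGraph V) (v : V) :
    H.degree v = ∑ w, if H.Adj v w then 1 else 0 := by
  rw [← SimpleGraph.card_neighborFinset_eq_degree, SimpleGraph.neighborFinset_eq_filter,
    Finset.card_filter]

open Classical in
-- The added neighbours of `i` are the clique vertices with index below `Δ - deg i`, where `Δ` is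
-- the maximum degree; `Δ ≤ M` ensures that they all exist.
theorem equalized_degree_castAdd (hM : G.maxDegree ≤ M) (i : Fin n) :
    (equalized G M).degree (Fin.castAdd M i) = G.maxDegree := by
  rw [SimpleGraph.degree_eq_sum, Fin.sum_univ_add]
  simp only [equalized_adj_castAdd_castAdd, equalized_adj_castAdd_natAdd]
  rw [← SimpleGraph.degree_eq_sum,
    Fin.sum_univ_eq_sum_range (fun j => if j + G.degree i < G.maxDegree then 1 else 0) M,
    ← Finset.card_filter]
  have h1 : (Finset.range M).filter (fun j => j + G.degree i < G.maxDegree) =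
      Finset.range (G.maxDegree - G.degree i) := by
    ext j
    simp only [Finset.mem_filter, Finset.mem_range]
    omega
  rw [h1, Finset.card_range]
  have := G.degree_le_maxDegree i
  omega

open Classical in
theorem le_equalized_degree_natAdd (j : Fin M) :
    M ≤ (equalized G M).degree (Fin.natAdd n j) + 1 := by
  rw [SimpleGraph.degree_eq_sum, Fin.sum_univ_add]
  simp only [equalized_adj_natAdd_natAdd]
  rw [← Finset.card_filter (fun x => j ≠ x) Finset.univ, Finset.filter_ne,
    Finset.card_erase_of_mem (Finset.mem_univ _), Finset.card_univ, Fintype.card_fin]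
  omega

theorem internalCount_equalized (U : Finset (Fin n)) :
    internalCount (equalized G M) (U.map (Fin.castAddEmb M)) = internalCount G U := by
  have hinj : Function.Injective (Fin.castAdd (n := n) M) := Fin.castAdd_injective n M
  rw [internalCount, internalCount, ← Set.ncard_image_of_injective _ (Sym2.map.injective hinj)]
  congr 1
  ext e
  constructor
  · rintro ⟨he, h⟩
    induction e with
    | _ a b =>
      obtain ⟨a, ha, rfl⟩ := Finset.mem_map.1 (h a (by simp))
      obtain ⟨b, hb, rfl⟩ := Finset.mem_map.1 (h b (by simp))
      refine ⟨s(a, b), ⟨?_, ?_⟩, by simp⟩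
      · exact (equalized_adj_castAdd_castAdd G M a b).1 he
      · simp [ha, hb]
  · rintro ⟨e, ⟨he, h⟩, rfl⟩
    induction e with
    | _ a b =>
      refine ⟨(equalized_adj_castAdd_castAdd G M a b).2 he, ?_⟩
      have ha := h a (by simp)
      have hb := h b (by simp)
      simp [ha, hb]

open Classical in
-- This is the purpose of the construction: on old vertices, minimizing touched edges at fixed
-- cardinality is maximizing the internal edges of `G`.
theorem touchCount_equalized (hM : G.maxDegree ≤ M) (U : Finset (Fin n)) :
    touchCount (equalized G M) (U.map (Fin.castAddEmb M)) + internalCount G U =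
      G.maxDegree * U.card := by
  have h : ∀ i ∈ U, (equalized G M).degree (Fin.castAddEmb M i) = G.maxDegree :=
    fun i _ => equalized_degree_castAdd G M hM i
  rw [← internalCount_equalized G M, touchCount_add_internalCount, Finset.sum_map,
    Finset.sum_congr rfl h, Finset.sum_const, smul_eq_mul, mul_comm]

/-- A single clique vertex already touches at least `M - 1` edges. -/
theorem exists_map_castAdd_of_touchCount {U : Finset (Fin (n + M))}
    (h : touchCount (equalized G M) U + 2 ≤ M) :
    ∃ W : Finset (Fin n), U = W.map (Fin.castAddEmb M) := by
  classical
  refine ⟨Finset.univ.filter fun i => Fin.castAdd M i ∈ U, ?_⟩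
  ext u
  induction u using Fin.addCases with
  | left i => simp
  | right j =>
    constructor
    · intro hj
      have h1 := degree_le_touchCount (equalized G M) hj
      have h2 := le_equalized_degree_natAdd G M j
      omega
    · intro hj
      obtain ⟨i, _, hi⟩ := Finset.mem_map.1 hj
      have := congrArg Fin.val hi
      simp at this
      omega

open Classical in
theorem maxDegree_le_self : G.maxDegree ≤ n := by
  refine G.maxDegree_le_of_forall_degree_le _ fun v => ?_
  have := G.degree_lt_card_verts v
  rw [Fintype.card_fin] at this
  exact this.le

open Classical in
/-- A set that is nearly as large as required, and touches in the equalized graph at most as many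
edges as `S`, can be extended or cut down to a set that induces nearly as many edges as `S`. -/
theorem internalCount_le_of_touchCount_le (hM : G.maxDegree ≤ M) {N k : ℕ}
    {S U W : Finset (Fin n)} (hS : S.card = k) (hW : W.card = k) (hUW : U ⊆ W ∨ W ⊆ U)
    (ht : touchCount (equalized G M) (U.map (Fin.castAddEmb M)) ≤
      touchCount (equalized G M) (S.map (Fin.castAddEmb M)))
    (hN : N * k ≤ (N + 1) * U.card) :
    (N + 1) * internalCount G S ≤ (N + 1) * internalCount G W + G.maxDegree * k := by
  have hS' := touchCount_equalized G M hM S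
  have hU' := touchCount_equalized G M hM U
  have hW' := touchCount_equalized G M hM W
  rw [hS] at hS'
  rw [hW] at hW'
  rcases hUW with h | h
  · have h1 := internalCount_mono G h
    have h2 : G.maxDegree * (N * k) ≤ G.maxDegree * ((N + 1) * U.card) :=
      Nat.mul_le_mul_left _ hN
    -- Padding case: the degree identities for `S` and `U` turn `t(U) ≤ t(S)` into a loss of at most
    -- `Δ(k - |U|)`, and `hN` gives `(N+1)(k - |U|) ≤ k`.
    have h3 : internalCount G S + G.maxDegree * U.card ≤
        internalCount G W + G.maxDegree * k := by omega
    have h4 := Nat.mul_le_mul_left (N + 1) h3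
    nlinarith
  · have h1 := touchCount_mono (equalized G M) (Finset.map_subset_map.2 h :
      W.map (Fin.castAddEmb M) ⊆ U.map (Fin.castAddEmb M))
    have h2 : internalCount G S ≤ internalCount G W := by omega
    exact (Nat.mul_le_mul_left _ h2).trans (Nat.le_add_right _ _)

end

/-! ### Approximation algorithms as functions -/

/-- The instances with a feasible solution. -/
structure OptProblem.Solvable (P : OptProblem) : Type where
  inst : P.Inst
  exists_feasible : ∃ S, P.Feasible inst S

instance (P : OptProblem) : TreeCode P.Solvable := ⟨fun I => P.encInst I.1⟩

/-- Choosing outputs turns an algorithm into a function on solvable instances, to which the closure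
properties of `PolyTime` apply. -/
theorem OptProblem.hasApprox_iff (P : OptProblem) (ρ : ℝ) : P.HasApprox ρ ↔
    ∃ F : (I : P.Solvable) → P.Sol I.1, PolyTime (fun I => P.encSol I.1 (F I)) ∧
      ∀ I, P.Feasible I.1 (F I) ∧
        ∀ S, P.Feasible I.1 S → P.WithinFactor ρ I.1 (F I) S := by
  constructor
  · rintro ⟨p, q, h⟩
    choose F t h1 h2 h3 h4 using fun I : P.Solvable => h I.1 I.2
    exact ⟨F, ⟨p, q, fun I => ⟨t I, h1 I, h2 I⟩⟩, fun I => ⟨h3 I, h4 I⟩⟩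
  · rintro ⟨F, ⟨p, q, h⟩, hF⟩
    refine ⟨p, q, fun I hI => ?_⟩
    obtain ⟨t, h1, h2⟩ := h ⟨I, hI⟩
    exact ⟨F ⟨I, hI⟩, t, h1, h2, hF ⟨I, hI⟩⟩

/-! ### Adjacency matrices -/

open Classical in
/-- The adjacency matrix. -/
noncomputable def adjRows {n : ℕ} (G : SimpleGraph (Fin n)) : List (List Bool) :=
  List.ofFn fun i : Fin n => List.ofFn fun j : Fin n => decide (G.Adj i j)

/-- The degree of a vertex, from the adjacency matrix. -/
def rowDegree (A : List (List Bool)) (u : ℕ) : ℕ := ((A.getD u []).filter fun b => b).length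

/-- The maximum degree, from the adjacency matrix. -/
def rowMaxDegree (A : List (List Bool)) : ℕ :=
  ((List.range A.length).map (rowDegree A)).foldr max 0

/-- The entries of the adjacency matrix of the equalized graph. -/
def equalizedEntry (A : List (List Bool)) (u v : ℕ) : Bool :=
  if u < A.length then
    if v < A.length then (A.getD u []).getD v false
    else decide (v - A.length + rowDegree A u < rowMaxDegree A)
  else
    if v < A.length then decide (u - A.length + rowDegree A v < rowMaxDegree A)
    else !decide (u = v)

/-- The number of vertices of the clique. -/
def cliqueSize (n : ℕ) : ℕ := n * n + 2

/-- The adjacency matrix of the equalized graph. -/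
def equalizedRows (A : List (List Bool)) : List (List Bool) :=
  (List.range (A.length + cliqueSize A.length)).map fun u =>
    (List.range (A.length + cliqueSize A.length)).map fun v => equalizedEntry A u v

theorem List.ofFn_eq_map_range {α : Type*} {n : ℕ} (f : Fin n → α) (g : ℕ → α)
    (h : ∀ i : Fin n, f i = g i) : List.ofFn f = (List.range n).map g := by
  refine List.ext_getElem (by simp) fun i h1 h2 => ?_
  simp only [List.getElem_ofFn, List.getElem_map, List.getElem_range, h]

theorem List.getD_ofFn {α : Type*} {n : ℕ} (f : Fin n → α) (i : Fin n) (d : α) :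
    (List.ofFn f).getD i d = f i := by
  rw [List.getD_eq_getElem _ _ (by simp)]
  simp

theorem List.length_filter_ofFn {n : ℕ} (f : Fin n → Bool) :
    ((List.ofFn f).filter fun b => b).length = ∑ i, if f i then 1 else 0 := by
  induction n with
  | zero => simp
  | succ n ih =>
    rw [List.ofFn_succ, List.filter_cons, Fin.sum_univ_succ, ← ih]
    split_ifs
    · rw [List.length_cons, add_comm]
    · rw [zero_add]

section

variable {n : ℕ} (G : SimpleGraph (Fin n))

theorem length_adjRows : (adjRows G).length = n := by simp [adjRows]

open Classical in
theorem getD_adjRows (i j : Fin n) :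
    ((adjRows G).getD i []).getD j false = decide (G.Adj i j) := by
  rw [adjRows, List.getD_ofFn, List.getD_ofFn]

open Classical in
theorem rowDegree_adjRows (i : Fin n) : rowDegree (adjRows G) i = G.degree i := by
  rw [rowDegree, adjRows, List.getD_ofFn, List.length_filter_ofFn, SimpleGraph.degree_eq_sum]
  simp

theorem List.foldr_max_le_iff {l : List ℕ} {B : ℕ} : l.foldr max 0 ≤ B ↔ ∀ a ∈ l, a ≤ B := by
  induction l with
  | nil => simp
  | cons a l ih => simp [ih]

open Classical in
theorem rowMaxDegree_adjRows : rowMaxDegree (adjRows G) = G.maxDegree := by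
  apply le_antisymm
  · rw [rowMaxDegree, List.foldr_max_le_iff]
    intro d hd
    obtain ⟨i, hi, rfl⟩ := List.mem_map.1 hd
    rw [List.mem_range, length_adjRows] at hi
    exact (rowDegree_adjRows G ⟨i, hi⟩).trans_le (G.degree_le_maxDegree _)
  · refine G.maxDegree_le_of_forall_degree_le _ fun v => ?_
    rw [← rowDegree_adjRows]
    refine List.foldr_max_le_iff.1 le_rfl _ (List.mem_map.2 ⟨v, ?_, rfl⟩)
    rw [List.mem_range, length_adjRows]
    exact v.2

theorem equalizedRows_adjRows :
    equalizedRows (adjRows G) = adjRows (equalized G (cliqueSize n)) := by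
  classical
  rw [equalizedRows, length_adjRows]
  symm
  refine List.ofFn_eq_map_range _ _ fun u => List.ofFn_eq_map_range _ _ fun v => ?_
  rw [Bool.eq_iff_iff, decide_eq_true_eq, equalizedEntry, length_adjRows, rowMaxDegree_adjRows]
  induction u using Fin.addCases with
  | left i =>
    induction v using Fin.addCases with
    | left j =>
      rw [equalized_adj_castAdd_castAdd]
      simp only [Fin.val_castAdd, Fin.is_lt, if_true, getD_adjRows, decide_eq_true_eq]
    | right j =>
      rw [equalized_adj_castAdd_natAdd]
      simp only [Fin.val_castAdd, Fin.val_natAdd, Fin.is_lt, if_true, rowDegree_adjRows,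
        decide_eq_true_eq, add_tsub_cancel_left, not_lt.2 (Nat.le_add_right n _), if_false]
  | right i =>
    induction v using Fin.addCases with
    | left j =>
      rw [equalized_adj_natAdd_castAdd]
      simp only [Fin.val_castAdd, Fin.val_natAdd, Fin.is_lt, if_true, rowDegree_adjRows,
        decide_eq_true_eq, add_tsub_cancel_left, not_lt.2 (Nat.le_add_right n _), if_false]
    | right j =>
      rw [equalized_adj_natAdd_natAdd]
      simp [Fin.ext_iff]

end

/-! ### Computing the equalized adjacency matrix in polynomial time -/

section

variable {α : Type} [TreeCode α]

theorem PolyTime.rowDegree {A : α → List (List Bool)} {u : α → ℕ} (hA : PolyTime A)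
    (hu : PolyTime u) : PolyTime fun x => rowDegree (A x) (u x) :=
  ((hA.getD hu []).filter (f := fun _ b => b) .snd).length

theorem PolyTime.rowMaxDegree {A : α → List (List Bool)} (hA : PolyTime A) :
    PolyTime fun x => rowMaxDegree (A x) :=
  (hA.length.range.map (f := fun x u => _root_.rowDegree (A x) u)
    ((hA.comp .fst).rowDegree .snd)).foldr_max

theorem PolyTime.equalizedEntry {A : α → List (List Bool)} {u v : α → ℕ} (hA : PolyTime A)
    (hu : PolyTime u) (hv : PolyTime v) : PolyTime fun x => equalizedEntry (A x) (u x) (v x) := by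
  have hd {u v : α → ℕ} (hu : PolyTime u) (hv : PolyTime v) :
      PolyTime fun x => decide (v x - (A x).length + _root_.rowDegree (A x) (u x) <
        _root_.rowMaxDegree (A x)) :=
    ((hv.natSub hA.length).natAdd (hA.rowDegree hu)).natLt hA.rowMaxDegree
  refine (PolyTime.ite (hu.natLt hA.length)
    (.ite (hv.natLt hA.length) ((hA.getD hu []).getD hv false) (hd hu hv))
    (.ite (hv.natLt hA.length) (hd hv hu) (hu.natEq hv).not)).congr fun x => ?_
  simp only [decide_eq_true_eq, _root_.equalizedEntry]

theorem PolyTime.cliqueSize {f : α → ℕ} (hf : PolyTime f) :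
    PolyTime fun x => cliqueSize (f x) :=
  (hf.natMul hf).natAdd (.const 2)

theorem PolyTime.equalizedRows {A : α → List (List Bool)} (hA : PolyTime A) :
    PolyTime fun x => equalizedRows (A x) := by
  have hN := (hA.length.natAdd hA.length.cliqueSize).range
  exact hN.map (PolyTime.map (hN.comp .fst) (PolyTime.equalizedEntry
    (hA.comp (PolyTime.fst.comp .fst)) (PolyTime.snd.comp .fst) .snd))

end

/-! ### Sets of a prescribed size -/

/-- The first `k` elements of a list of the numbers below `n` that starts with those for which
`g` is true. -/
def firstChosen (g : ℕ → Bool) (n k : ℕ) : List ℕ :=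
  (((List.range n).filter g) ++ ((List.range n).filter fun i => !g i)).take k

/-- The set of the elements of `firstChosen g n k`. -/
def chosenSet (g : ℕ → Bool) (n k : ℕ) : Finset (Fin n) :=
  Finset.univ.filter fun i => (i : ℕ) ∈ firstChosen g n k

theorem mem_chosenSet {g : ℕ → Bool} {n k : ℕ} {i : Fin n} :
    i ∈ chosenSet g n k ↔ (i : ℕ) ∈ firstChosen g n k := by
  simp [chosenSet]

theorem card_chosenSet (g : ℕ → Bool) {n k : ℕ} (hk : k ≤ n) : (chosenSet g n k).card = k := by
  -- The reordered list is a permutation of `0, …, n - 1`, so its first `k` entries are distinct.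
  have hp := List.filter_append_perm g (List.range n)
  have hnd : (firstChosen g n k).Nodup :=
    (hp.nodup_iff.2 List.nodup_range).sublist (List.take_sublist _ _)
  have hlen : (firstChosen g n k).length = k := by
    rw [firstChosen, List.length_take, hp.length_eq, List.length_range, min_eq_left hk]
  have hmap : (chosenSet g n k).map Fin.valEmbedding = (firstChosen g n k).toFinset := by
    ext j
    simp only [Finset.mem_map, mem_chosenSet, Fin.valEmbedding_apply, List.mem_toFinset]
    constructor
    · rintro ⟨i, hi, rfl⟩
      exact hi
    · intro hj
      have : j < n := List.mem_range.1 (hp.subset (List.mem_of_mem_take hj))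
      exact ⟨⟨j, this⟩, hj, rfl⟩
  rw [← Finset.card_map, hmap, List.toFinset_card_of_nodup hnd, hlen]

/-- The elements with `g` come first, so a prefix either exhausts them or consists of them. Thus one
construction handles both padding and trimming. -/
theorem chosenSet_comparable (g : ℕ → Bool) (n k : ℕ) :
    (∀ i : Fin n, g i → i ∈ chosenSet g n k) ∨ (∀ i ∈ chosenSet g n k, g i) := by
  simp only [mem_chosenSet, firstChosen]
  rcases le_total k ((List.range n).filter g).length with h | h
  · right
    intro i hi
    rw [List.take_append_of_le_length h] at hi
    exact (List.mem_filter.1 (List.mem_of_mem_take hi)).2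
  · left
    intro i hi
    rw [List.take_append, List.take_of_length_le h]
    exact List.mem_append_left _ (List.mem_filter.2 ⟨List.mem_range.2 i.2, hi⟩)

theorem PolyTime.chosenSet {α : Type} [TreeCode α] {g : α → ℕ → Bool} {n k : α → ℕ}
    (hg : PolyTime fun p : α × ℕ => g p.1 p.2) (hn : PolyTime n) (hk : PolyTime k) :
    PolyTime fun x => encVertexSet (chosenSet (g x) (n x) (k x)) := by
  have h : PolyTime fun x => firstChosen (g x) (n x) (k x) :=
    PolyTime.take hk (PolyTime.append (hn.range.filter hg) (hn.range.filter hg.not))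
  refine (hn.range.map (f := fun x i => decide (i ∈ firstChosen (g x) (n x) (k x)))
    (PolyTime.contains (h.comp .fst) .snd)).recode fun x => ?_
  rw [← List.ofFn_eq_map_range
    (fun i : Fin (n x) => decide (i ∈ _root_.chosenSet (g x) (n x) (k x)))]
  · rfl
  · intro i
    simp only [mem_chosenSet]

/-! ### The reduction -/

/-- The instances of Dense `k`-subgraph with `k ≤ n`. -/
structure DenseInst : Type where
  inst : DkSInstance
  k_le_n : inst.k ≤ inst.n

noncomputable instance : TreeCode DenseInst := ⟨fun I => denseKSubgraph.encInst I.1⟩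

theorem PolyTime.adjRows : PolyTime fun I : DenseInst => adjRows I.1.graph :=
  (PolyTime.fst (α := List (List Bool)) (β := List Bool)).precode
    (fun I : DenseInst => (_root_.adjRows I.1.graph, I.1.k.bits)) (fun _ => rfl) fun _ => rfl

theorem PolyTime.order : PolyTime fun I : DenseInst => I.1.n :=
  PolyTime.adjRows.length.congr fun _ => length_adjRows _

/-- The input gives `k` in binary; conversion to unary is affordable only because `k ≤ n`. -/
theorem PolyTime.subgraphSize : PolyTime fun I : DenseInst => I.1.k :=
  PolyTime.ofBits ((PolyTime.snd (α := List (List Bool)) (β := List Bool)).precode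
    (fun I : DenseInst => (_root_.adjRows I.1.graph, I.1.k.bits)) (fun _ => rfl) fun _ => rfl)
    PolyTime.order fun I => I.2

/-- The instance of MWEC on the equalized graph with unit weights and budget `m`. -/
noncomputable def coverInst (I : DenseInst) (m : ℕ) : WeightedInstance where
  n := I.1.n + cliqueSize I.1.n
  graph := equalized I.1.graph (cliqueSize I.1.n)
  weight _ := 1
  bound := m

theorem touchCount_empty {n : ℕ} (G : SimpleGraph (Fin n)) : touchCount G ∅ = 0 := by
  simp [touchCount]

/-- `coverInst` as a solvable instance of unweighted MWEC. -/
noncomputable def solvableCoverInst (I : DenseInst) (m : ℕ) :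
    (mwec.restrict {I | I.Unweighted}).Solvable :=
  ⟨⟨coverInst I m, fun _ => rfl⟩, (∅ : Finset _), (touchCount_empty _).trans_le (Nat.zero_le _)⟩

theorem PolyTime.solvableCoverInst :
    PolyTime fun p : DenseInst × ℕ => solvableCoverInst p.1 p.2 := by
  have hA : PolyTime fun p : DenseInst × ℕ => _root_.adjRows p.1.1.graph :=
    PolyTime.adjRows.comp .fst
  have hn : PolyTime fun p : DenseInst × ℕ => p.1.1.n := PolyTime.order.comp .fst
  -- `[true]` is the binary form of the weight 1; the budget, a unary loop counter, is converted to
  -- binary.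
  refine (hA.equalizedRows.pair (((hn.natAdd hn.cliqueSize).range.map (f := fun _ _ => [true])
    (.const _)).pair (PolyTime.natBits .snd))).recode fun p => ?_
  have h1 : encList encNat (List.ofFn (coverInst p.1 p.2).weight) =
      code ((List.range (p.1.1.n + _root_.cliqueSize p.1.1.n)).map fun _ => [true]) := by
    have h0 : List.ofFn (coverInst p.1 p.2).weight =
        (List.range (p.1.1.n + _root_.cliqueSize p.1.1.n)).map fun _ => 1 :=
      List.ofFn_eq_map_range _ _ fun _ => rfl
    rw [h0]
    generalize List.range _ = l
    induction l with
    | nil => rfl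
    | cons a l ih =>
      rw [List.map_cons, List.map_cons, encList, ih]
      rw [encNat, Nat.one_bits]
      rfl
  have h2 : code (_root_.solvableCoverInst p.1 p.2) = (coverInst p.1 p.2).enc := rfl
  rw [h2, WeightedInstance.enc, h1, equalizedRows_adjRows]
  rfl

/-- The characteristic vector of a set of vertices. -/
def vertexMask {n : ℕ} (U : Finset (Fin n)) : List Bool :=
  List.ofFn fun i : Fin n => decide (i ∈ U)

theorem length_filter_vertexMask {n : ℕ} (U : Finset (Fin n)) :
    ((vertexMask U).filter fun b => b).length = U.card := by
  rw [vertexMask, List.length_filter_ofFn]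
  simp

theorem getD_vertexMask {n : ℕ} (U : Finset (Fin n)) (i : Fin n) :
    (vertexMask U).getD i false = decide (i ∈ U) := by
  rw [vertexMask, List.getD_ofFn]

open Classical in
/-- A PTAS for unweighted MWEC finds sets of `k` vertices that induce nearly as many edges as
possible, where the error is measured against `k` times the maximum degree. -/
theorem exists_polyTime_dense (h : (mwec.restrict {I | I.Unweighted}).HasPTAS) {N : ℕ}
    (hN : 1 ≤ N) :
    ∃ W : (I : DenseInst) → Finset (Fin I.1.n), PolyTime (fun I => encVertexSet (W I)) ∧
      ∀ I, (W I).card = I.1.k ∧ ∀ S : Finset (Fin I.1.n), S.card = I.1.k →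
        (N + 1) * internalCount I.1.graph S ≤
          (N + 1) * internalCount I.1.graph (W I) + I.1.graph.maxDegree * I.1.k := by
  have hN' : (0 : ℝ) < N := by exact_mod_cast hN
  obtain ⟨F, hF, hF'⟩ := (OptProblem.hasApprox_iff _ _).1 (h (1 / N) (by positivity))
  let U (I : DenseInst) (m : ℕ) : Finset (Fin (I.1.n + cliqueSize I.1.n)) :=
    F (solvableCoverInst I m)
  have hU : PolyTime fun p : DenseInst × ℕ => vertexMask (U p.1 p.2) :=
    (PolyTime.comp hF PolyTime.solvableCoverInst).recode fun _ => rfl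
  have hU1 (I : DenseInst) (m : ℕ) :
      touchCount (equalized I.1.graph (cliqueSize I.1.n)) (U I m) ≤ m :=
    (hF' (solvableCoverInst I m)).1
  have hU2 (I : DenseInst) (m : ℕ) (S : Finset (Fin (I.1.n + cliqueSize I.1.n)))
      (hS : touchCount (equalized I.1.graph (cliqueSize I.1.n)) S ≤ m) :
      N * S.card ≤ (N + 1) * (U I m).card := by
    have h1 := (hF' (solvableCoverInst I m)).2 S hS
    have h2 : ((∑ v ∈ S, 1 : ℕ) : ℝ) ≤ (1 + 1 / N) * ((∑ v ∈ U I m, 1 : ℕ) : ℝ) := h1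
    rw [Finset.sum_const, Finset.sum_const, smul_eq_mul, smul_eq_mul, mul_one, mul_one] at h2
    have h3 : (N : ℝ) * S.card ≤ (N + 1) * (U I m).card := by
      calc (N : ℝ) * S.card ≤ N * ((1 + 1 / N) * (U I m).card) := by gcongr
        _ = (N + 1) * (U I m).card := by field_simp
    exact_mod_cast h3
  let large (I : DenseInst) (m : ℕ) : Bool :=
    decide (N * I.1.k ≤ (N + 1) * ((vertexMask (U I m)).filter fun b => b).length)
  -- The budgets `0, …, n²` suffice, since a `k`-set of old vertices touches at most `Δk ≤ n²`
  -- edges.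
  let budget (I : DenseInst) : ℕ := leastBelow (large I) (I.1.n * I.1.n + 1)
  have hbudget : PolyTime budget := by
    refine PolyTime.leastBelow (PolyTime.natLe (PolyTime.natMul (.const N)
      (PolyTime.subgraphSize.comp .fst)) (PolyTime.natMul (.const (N + 1))
        (PolyTime.length (hU.filter (f := fun _ b => b) .snd))))
      (PolyTime.succ (PolyTime.order.natMul PolyTime.order))
  refine ⟨fun I => chosenSet (fun i => (vertexMask (U I (budget I))).getD i false) I.1.n I.1.k,
    ?_, fun I => ⟨card_chosenSet _ I.2, fun S hS => ?_⟩⟩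
  · refine PolyTime.chosenSet (g := fun I i => (vertexMask (U I (budget I))).getD i false)
      (PolyTime.getD ?_ .snd false) PolyTime.order PolyTime.subgraphSize
    exact (hU.comp (PolyTime.id.pair hbudget)).comp .fst
  have hdeg := maxDegree_le_self I.1.graph
  have hsq : I.1.n ≤ I.1.n * I.1.n := Nat.le_mul_self _
  -- With `n² + 2` clique vertices, each has degree at least `n² + 1`, beyond every budget tried.
  have hsize : cliqueSize I.1.n = I.1.n * I.1.n + 2 := rfl
  have hM : I.1.graph.maxDegree ≤ cliqueSize I.1.n := by omega
  have ht := touchCount_equalized I.1.graph _ hM S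
  have hk : I.1.graph.maxDegree * S.card ≤ I.1.n * I.1.n := by
    rw [hS]
    exact Nat.mul_le_mul hdeg I.2
  have hcard := hU2 I _ (S.map (Fin.castAddEmb _)) le_rfl
  rw [Finset.card_map, hS] at hcard
  -- The budget `t(S)` admits `S` itself, so its answer is large enough; hence the least successful
  -- budget is at most `t(S)`, for every `S` at once.
  obtain ⟨hb1, hb2⟩ := leastBelow_spec (p := large I) (T := I.1.n * I.1.n + 1)
    (m := touchCount (equalized I.1.graph (cliqueSize I.1.n)) (S.map (Fin.castAddEmb _)))
    (by omega) (by simpa only [large, decide_eq_true_eq, length_filter_vertexMask] using hcard)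
  have htU := hU1 I (budget I)
  obtain ⟨U₀, hU₀⟩ := exists_map_castAdd_of_touchCount I.1.graph (cliqueSize I.1.n)
    (U := U I (budget I)) (by
      have : budget I ≤ I.1.n * I.1.n := hb2.trans (by omega)
      omega)
  have hmask (i : Fin I.1.n) : (vertexMask (U I (budget I))).getD i false = decide (i ∈ U₀) := by
    have := getD_vertexMask (U I (budget I)) (Fin.castAdd _ i)
    rw [Fin.val_castAdd] at this
    rw [this, hU₀]
    simp
  refine internalCount_le_of_touchCount_le I.1.graph (cliqueSize I.1.n) hM hS
    (card_chosenSet _ I.2) (U := U₀) ?_ ?_ ?_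
  · rcases chosenSet_comparable (fun i => (vertexMask (U I (budget I))).getD i false)
      I.1.n I.1.k with h | h
    · exact Or.inl fun i hi => h i (by rw [hmask]; simpa using hi)
    · exact Or.inr fun i hi => by
        have := h i hi
        rw [hmask] at this
        simpa using this
  · rw [← hU₀]
    exact htU.trans hb2
  · have : large I (budget I) := hb1
    simpa only [large, decide_eq_true_eq, length_filter_vertexMask, hU₀, Finset.card_map]
      using this

/-! ### The two consequences -/

theorem WeightedInstance.sum_weight {I : WeightedInstance} (hI : I.Unweighted)
    (S : Finset (Fin I.n)) : ∑ v ∈ S, I.weight v = S.card := by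
  rw [Finset.sum_congr rfl fun v _ => hI v, Finset.sum_const, smul_eq_mul, mul_one]

open Classical in
-- Regularity makes the additive error relative: `Δk` is the degree sum of a `k`-set, at most twice
-- the number of edges it touches.
theorem fcec_hasPTAS (h : (mwec.restrict {I | I.Unweighted}).HasPTAS) :
    (fcec.restrict {I | I.Unweighted ∧ I.Regular}).HasPTAS := by
  intro ε hε
  obtain ⟨N, hN⟩ := exists_nat_gt (2 / ε)
  have hN0 : (0 : ℝ) < N := lt_trans (by positivity) hN
  obtain ⟨W, hW, hW'⟩ := exists_polyTime_dense h (N := N) (by exact_mod_cast hN0)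
  have hle (I : (fcec.restrict {I | I.Unweighted ∧ I.Regular}).Solvable) :
      I.1.1.bound ≤ I.1.1.n := by
    obtain ⟨S, hS⟩ := I.2
    exact (hS.trans_eq (WeightedInstance.sum_weight I.1.2.1 S)).trans (card_finset_fin_le S)
  let D (I : (fcec.restrict {I | I.Unweighted ∧ I.Regular}).Solvable) : DenseInst :=
    ⟨⟨I.1.1.n, I.1.1.graph, I.1.1.bound⟩, hle I⟩
  have hD : PolyTime D := by
    refine PolyTime.precode (β := List (List Bool) × Data × List Bool)
      (f := fun x => (x.1, x.2.2)) (PolyTime.fst.pair (PolyTime.snd.comp .snd))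
      (fun I : (fcec.restrict {I | I.Unweighted ∧ I.Regular}).Solvable =>
        (adjRows I.1.1.graph, encList encNat (List.ofFn I.1.1.weight), I.1.1.bound.bits))
      (fun _ => rfl) fun _ => rfl
  refine (OptProblem.hasApprox_iff _ _).2 ⟨fun I => W (D I), hW.comp hD, fun I => ⟨?_, ?_⟩⟩
  · exact (hW' (D I)).1.ge.trans_eq (WeightedInstance.sum_weight I.1.2.1 _).symm
  · intro S hS
    have hcardS : I.1.1.bound ≤ S.card := hS.trans_eq (WeightedInstance.sum_weight I.1.2.1 S)
    change (touchCount I.1.1.graph (W (D I)) : ℝ) ≤ (1 + ε) * touchCount I.1.1.graph S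
    -- A competitor may exceed the bound; trimming it to exactly that many vertices only lowers its
    -- cost.
    obtain ⟨S', hS', hcard⟩ := Finset.exists_subset_card_eq hcardS
    obtain ⟨hW1, hW2⟩ := hW' (D I)
    have h1 := hW2 S' hcard
    obtain ⟨Δ, hΔ⟩ := I.1.2.2
    have hreg (T : Finset (Fin I.1.1.n)) : touchCount I.1.1.graph T +
        internalCount I.1.1.graph T = T.card * Δ := by
      rw [touchCount_add_internalCount, Finset.sum_congr rfl fun v _ => hΔ v, Finset.sum_const,
        smul_eq_mul]
    -- Only an inequality: on the empty vertex set every `Δ` is a degree of regularity.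
    have hmax : I.1.1.graph.maxDegree ≤ Δ :=
      I.1.1.graph.maxDegree_le_of_forall_degree_le _ fun v => (hΔ v).le
    have hWr := hreg (W (D I))
    have hSr := hreg S'
    rw [hW1] at hWr
    rw [hcard] at hSr
    change (N + 1) * internalCount I.1.1.graph S' ≤ (N + 1) * internalCount I.1.1.graph (W (D I))
      + I.1.1.graph.maxDegree * I.1.1.bound at h1
    change touchCount I.1.1.graph (W (D I)) + internalCount I.1.1.graph (W (D I)) =
      I.1.1.bound * Δ at hWr
    have h2 := internalCount_le_touchCount I.1.1.graph S'
    have h3 := touchCount_mono I.1.1.graph hS'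
    have h4 : I.1.1.graph.maxDegree * I.1.1.bound ≤ 2 * touchCount I.1.1.graph S' := by
      have := Nat.mul_le_mul_right I.1.1.bound hmax
      rw [mul_comm Δ] at this
      omega
    have h5 : (N + 1) * touchCount I.1.1.graph (W (D I)) ≤
        (N + 1) * touchCount I.1.1.graph S' + 2 * touchCount I.1.1.graph S' := by
      nlinarith
    have h6 : ((N : ℝ) + 1) * touchCount I.1.1.graph (W (D I)) ≤
        ((N : ℝ) + 1 + 2) * touchCount I.1.1.graph S := by
      have h7 : (N + 1) * touchCount I.1.1.graph (W (D I)) ≤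
          (N + 1 + 2) * touchCount I.1.1.graph S := by nlinarith
      exact_mod_cast h7
    -- The ratio reached is `1 + 2/(N+1)`, whence the choice `N > 2/ε`.
    rw [div_lt_iff₀ hε] at hN
    have h8 : (N : ℝ) + 1 + 2 ≤ (N + 1) * (1 + ε) := by nlinarith
    have h9 : ((N : ℝ) + 1 + 2) * touchCount I.1.1.graph S ≤
        (N + 1) * (1 + ε) * touchCount I.1.1.graph S :=
      mul_le_mul_of_nonneg_right h8 (Nat.cast_nonneg _)
    refine le_of_mul_le_mul_left (a := (N : ℝ) + 1) ?_ (by positivity)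
    rw [← mul_assoc]
    exact h6.trans h9

open Classical in
-- With `r = n^{1/3}` and `O` optimal, `Δk ≤ c₁rk` and `crk ≤ 2e(O)`. For `N > 4c₁/c` this makes
-- `Δk` at most `(N/2)e(O)`, so at least half of the optimum survives.
theorem denseKSubgraph_hasConstantApprox (h : (mwec.restrict {I | I.Unweighted}).HasPTAS)
    {c₁ a b c d : ℝ} (hc₁ : 0 < c₁) (hc : 0 < c) :
    (denseKSubgraph.restrict {I | ModifiedDkS c₁ a b c d I}).HasConstantApprox := by
  obtain ⟨N, hN⟩ := exists_nat_gt (4 * c₁ / c)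
  have hN0 : (0 : ℝ) < N := lt_trans (by positivity) hN
  obtain ⟨W, hW, hW'⟩ := exists_polyTime_dense h (N := N) (by exact_mod_cast hN0)
  let D (I : (denseKSubgraph.restrict {I | ModifiedDkS c₁ a b c d I}).Solvable) : DenseInst :=
    ⟨I.1.1, by
      obtain ⟨S, hS⟩ := I.2
      have hS' : S.card = I.1.1.k := hS
      rw [← hS']
      exact card_finset_fin_le S⟩
  have hD : PolyTime D := PolyTime.id.recode fun _ => rfl
  refine ⟨2, (OptProblem.hasApprox_iff _ _).2
    ⟨fun I => W (D I), hW.comp hD, fun I => ⟨(hW' (D I)).1, fun S hS => ?_⟩⟩⟩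
  change S.card = I.1.1.k at hS
  change (internalCount I.1.1.graph S : ℝ) ≤ 2 * internalCount I.1.1.graph (W (D I))
  obtain ⟨hdeg, _, O, hO, hmax, hlow, _⟩ := I.1.2
  have hSO : (internalCount I.1.1.graph S : ℝ) ≤ internalCount I.1.1.graph O := by
    exact_mod_cast hmax S hS
  refine hSO.trans ?_
  have h1 : ((N : ℝ) + 1) * internalCount I.1.1.graph O ≤
      (N + 1) * internalCount I.1.1.graph (W (D I)) + I.1.1.graph.maxDegree * I.1.1.k := by
    exact_mod_cast (hW' (D I)).2 O hO
  set r : ℝ := (I.1.1.n : ℝ) ^ (1 / 3 : ℝ) with hr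
  have hr0 : 0 ≤ r := Real.rpow_nonneg (Nat.cast_nonneg _) _
  have h2 : (I.1.1.graph.maxDegree : ℝ) ≤ c₁ * r := by
    rcases isEmpty_or_nonempty (Fin I.1.1.n) with hn | hn
    · have : I.1.1.graph.maxDegree ≤ 0 :=
        I.1.1.graph.maxDegree_le_of_forall_degree_le _ fun v => hn.elim v
      rw [Nat.le_zero.1 this, Nat.cast_zero]
      positivity
    · obtain ⟨v, hv⟩ := I.1.1.graph.exists_maximal_degree_vertex
      rw [hv]
      exact hdeg v
  have h3 : c * r * I.1.1.k ≤ 2 * internalCount I.1.1.graph O := by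
    -- For `k = 0` the average degree is a division by zero and carries no information, but the
    -- claim is trivial.
    rcases Nat.eq_zero_or_pos I.1.1.k with h0 | h0
    · rw [h0, Nat.cast_zero, mul_zero]
      positivity
    · exact (le_div_iff₀ (by exact_mod_cast h0)).1 hlow
  have hk0 : (0 : ℝ) ≤ I.1.1.k := Nat.cast_nonneg _
  have h4 : (I.1.1.graph.maxDegree : ℝ) * I.1.1.k ≤ c₁ * r * I.1.1.k :=
    mul_le_mul_of_nonneg_right h2 hk0
  rw [div_lt_iff₀ hc] at hN
  have h5 : 4 * c₁ * (r * I.1.1.k) ≤ N * c * (r * I.1.1.k) :=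
    mul_le_mul_of_nonneg_right hN.le (mul_nonneg hr0 hk0)
  have h6 : (N : ℝ) * (c * r * I.1.1.k) ≤ N * (2 * internalCount I.1.1.graph O) :=
    mul_le_mul_of_nonneg_left h3 hN0.le
  have h7 : (0 : ℝ) ≤ internalCount I.1.1.graph O := Nat.cast_nonneg _
  refine le_of_mul_le_mul_left (a := (N : ℝ) + 1) ?_ (by positivity)
  nlinarith

theorem OptProblem.HasPTAS.restrict {P : OptProblem} (h : P.HasPTAS) (C : Set P.Inst) :
    (P.restrict C).HasPTAS := by
  intro ε hε
  obtain ⟨p, q, hp⟩ := h ε hε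
  exact ⟨p, q, fun I hI => hp I.1 hI⟩

/-- A PTAS for unweighted MWEC gives a PTAS for unweighted FCEC on regular instances, and MWEC,
even unweighted, has no PTAS unless the modified Dense `k`-subgraph instances admit a
constant-factor approximation. -/
theorem mainTheorem5 :
    ((mwec.restrict {I | I.Unweighted}).HasPTAS →
      (fcec.restrict {I | I.Unweighted ∧ I.Regular}).HasPTAS) ∧
    (∀ c₁ a b c d : ℝ, 0 < c₁ → 0 < a → 0 < b → 0 < c → 0 < d →
      ¬ (denseKSubgraph.restrict {I | ModifiedDkS c₁ a b c d I}).HasConstantApprox →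
      ¬ (mwec.restrict {I | I.Unweighted}).HasPTAS ∧ ¬ mwec.HasPTAS) := by
  refine ⟨fcec_hasPTAS, fun c₁ a b c d hc₁ _ _ hc _ hno => ?_⟩
  have h : ¬ (mwec.restrict {I | I.Unweighted}).HasPTAS :=
    fun h => hno (denseKSubgraph_hasConstantApprox h hc₁ hc)
  exact ⟨h, fun h' => h (h'.restrict _)⟩
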